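/- **Setting.** Let $L\subset S^2$ be a link diagram (a generic projection with over/under information at every crossing; it may be disconnected and may have crossingless components), with a marked point $p$ on $L$ away from the crossings. Let $X$ be its set of crossings, let $F$ be its set of faces (components of the complement of the projection), and let $R=\mathbb Z/2[x_f : f\in F]$. For $S\subseteq X$ let $L_S$ be the resolution of $L$ in which the crossings in $S$ are $1$-resolved and the others $0$-resolved. It is a union of disjoint circles; the circle $C_0$ through $p$ is called marked, and $C_1,\dots,C_k$ are the unmarked ones. An arc joining the two new strands at each resolved crossing keeps the faces of $L_S$ in bijection with $F$. For an unmarked circle $C$ let $[C]=\sum x_f\in R$, where $f$ runs over the faces in the component of $S^2\setminus C$ that does not contain $p$. **The complex.** For $r\in R$ let $\mathcal K(r)$ be the complex $Rv_+\to Rv_-$, $v_+\mapsto r\,v_-$, with $v_\pm$ in grading $\pm1$. Put $\mathcal V(L_S)=Rv_0\otimes_R\mathcal K([C_1])\otimes_R\cdots\otimes_R\mathcal K([C_k])$, with $v_0$ in grading $0$ and with the tensor product differential $\partial_{\mathcal V(L_S)}$. Let $\widetilde{KT}(L)=\bigoplus_{S\subseteq X}\mathcal V(L_S)\{|S|\}$,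 bigraded by $h=|S|$ and by $q$, the grading of $\mathcal V(L_S)$ increased by $|S|$; elements of $R$ have bidegree $(0,0)$. Let $\partial_{\mathcal V}=\bigoplus_S\partial_{\mathcal V(L_S)}$. Let $\partial_{KH}$ be the sum, over all $S$ and all $x\in X\setminus S$, of the $R$-linear maps $\partial_{S,x}:\mathcal V(L_S)\to\mathcal V(L_{S\cup\{x\}})$ which are the identity on the factors of the circles not passing through $x$, and on the remaining factors are given by $\mu$ if two circles of $L_S$ merge at $x$, and by $\Delta$ if one circle of $L_S$ divides at $x$, where $$\mu:\; v_+\otimes v_+\mapsto v_+,\quad v_+\otimes v_-,\ v_-\otimes v_+\mapsto v_-,\quad v_-\otimes v_-\mapsto 0,\quad v_+\otimes v_0\mapsto v_0,\quad v_-\otimes v_0\mapsto 0,$$ $$\Delta:\; v_+\mapsto v_+\otimes v_-+v_-\otimes v_+,\quad v_-\mapsto v_-\otimes v_-,\quad v_0\mapsto v_0\otimes v_-.$$ **Theorem.** Let $S\subseteq X$ and $x\in X\setminus S$. 1. If the two strands of $L_S$ at $x$ lie on different circles $C_1,C_2$, then these merge into a single circle $C$ of $L_{S\cup\{x\}}$,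 and if $C_1,C_2$ (hence $C$) are unmarked, then $[C]=[C_1]+[C_2]$. 2. If they lie on one circle $C$, then $C$ divides into two different circles $C_1,C_2$ of $L_{S\cup\{x\}}$, and if $C$ (hence $C_1,C_2$) is unmarked, then $[C]=[C_1]+[C_2]$. 3. The map $\partial_{S,x}$ is a chain map: $\partial_{S,x}\circ\partial_{\mathcal V(L_S)}=\partial_{\mathcal V(L_{S\cup\{x\}})}\circ\partial_{S,x}$. Moreover, $\partial_{KH}$ maps $\widetilde{KT}^{i,j}(L)$ into $\widetilde{KT}^{i+1,j}(L)$ and $\partial_{\mathcal V}$ maps $\widetilde{KT}^{i,j}(L)$ into $\widetilde{KT}^{i,j-2}(L)$ for all $i,j\in\mathbb Z$, both maps square to zero, and $\widetilde\partial=\partial_{KH}+\partial_{\mathcal V}$ is a differential on $\widetilde{KT}(L)$, that is, $\widetilde\partial\circ\widetilde\partial=0$. -/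

import Mathlib

namespace TotallyTwisted

/-- The half-edges of a diagram with crossing set `X` and set `J` of auxiliary two-valent vertices
(joints). Every crossing carries four half-edges, numbered counterclockwise; those numbered `0`
and `2` belong to the under-strand, those numbered `1` and `3` to the over-strand. Every joint
carries two half-edges. Joints are plain points on the strands: they allow components without
crossings. -/
abbrev HalfEdge (X J : Type*) := (X × Fin 4) ⊕ (J × Fin 2)

/-- The next half-edge, counterclockwise around the same vertex. -/
def rot {X J : Type*} : HalfEdge X J → HalfEdge X J
  | .inl (x, i) => .inl (x, i + 1)
  | .inr (j, i) => .inr (j, i + 1)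

/-- A link diagram on the sphere `S²` with a marked point, as a combinatorial map: `X` is the set of
crossings, `F` the set of faces (the components of the complement of the projection). The diagram
need not be connected, so a face may have several boundary cycles. -/
structure LinkDiagram (X J F : Type*) [Fintype X] [Fintype J] [Fintype F] where
  /-- The other half of the edge. -/
  glue : HalfEdge X J → HalfEdge X J
  glue_glue : ∀ h, glue (glue h) = h
  glue_ne : ∀ h, glue h ≠ h
  /-- The face on the left of the half-edge `h`, looking away from its vertex; it contains the corner
  between `h` and `rot h`. -/
  face : HalfEdge X J → F
  /-- The left side of `h` is the right side of `rot h`. -/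
  face_glue_rot : ∀ h, face (glue (rot h)) = face h
  face_surjective : Function.Surjective face
  /-- The surface is connected: one can pass between any two faces by crossing edges. -/
  surface_connected : Subsingleton (Quot fun f g : F => ∃ h, f = face h ∧ g = face (glue h))
  /-- The surface is the sphere: Euler's formula `V - E + F = 1 + c` for a graph with `c` connected
  components drawn on the sphere. Here `V = |X| + |J|` and `E = (4|X| + 2|J|) / 2`. -/
  euler : ((Fintype.card X + Fintype.card J : ℕ) : ℤ) - ((2 * Fintype.card X + Fintype.card J : ℕ) : ℤ)
      + (Fintype.card F : ℤ)
    = 1 + (Nat.card (Quot fun h k : HalfEdge X J => k = glue h ∨ k = rot h) : ℤ)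
  /-- The marked point lies in the interior of the edge containing this half-edge. -/
  mark : HalfEdge X J

/-- The basis labels `v₊` and `v₋`. -/
inductive Sgn
  | plus
  | minus
  deriving DecidableEq

namespace Sgn

instance : Fintype Sgn :=
  ⟨{plus, minus}, fun s => by cases s <;> simp⟩

/-- `v₊` and `v₋` have gradings `1` and `-1`. -/
def deg : Sgn → ℤ
  | plus => 1
  | minus => -1

end Sgn

section Koszul

variable {R ι : Type*} [CommRing R] [DecidableEq ι] [Fintype ι]

/-- The module of the Koszul complex `⨂ᵢ (R v₊ ⟶ R v₋)`: it is free on the tensors of the basis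
vectors `v₊`, `v₋`, one for each index. -/
abbrev Koszul (R ι : Type*) [CommRing R] := (ι → Sgn) →₀ R

/-- The differential `v₊ ↦ r i • v₋`, `v₋ ↦ 0` of the `i`-th factor, tensored with the identity on
the other factors. -/
noncomputable def koszulFactor (r : ι → R) (i : ι) : Koszul R ι →ₗ[R] Koszul R ι :=
  Finsupp.linearCombination R fun s : ι → Sgn =>
    match s i with
    | .plus => Finsupp.single (Function.update s i Sgn.minus) (r i)
    | .minus => 0

/-- The differential of the tensor product (characteristic two, so there are no signs). -/
noncomputable def koszulD (r : ι → R) : Koszul R ι →ₗ[R] Koszul R ι :=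
  ∑ i, koszulFactor r i

end Koszul

/-- The basis vector on a circle: `some ±` is `v₊`, `v₋`, and `none` is the vector `v₀` of the marked
circle. -/
abbrev Label := Option Sgn

/-- The basis vectors occurring in `μ (a ⊗ b)`, each with coefficient one. -/
def mu : Label → Label → Finset Label
  | some .plus, some .plus => {some .plus}
  | some .plus, some .minus => {some .minus}
  | some .minus, some .plus => {some .minus}
  | some .minus, some .minus => ∅
  | some .plus, none => {none}
  | none, some .plus => {none}
  | some .minus, none => ∅
  | none, some .minus => ∅
  | none, none => ∅

/-- The basis vectors occurring in `Δ a`, each with coefficient one. For `Δ v₀ = v₀ ⊗ v₋` both orders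
of the two factors are listed: the one where `v₀` sits on the marked circle is meant. -/
def delta : Label → Finset (Label × Label)
  | some .plus => {(some .plus, some .minus), (some .minus, some .plus)}
  | some .minus => {(some .minus, some .minus)}
  | none => {(none, some .minus), (some .minus, none)}

namespace LinkDiagram

variable {X J F : Type*} [Fintype X] [Fintype J] [Fintype F] [DecidableEq X]

/-- How the strands are joined at the vertices in the resolution `L_S`. At a crossing outside `S`
(`0`-resolution) `0` is joined to `1` and `2` to `3`; at a crossing in `S` (`1`-resolution) `1` is
joined to `2` and `3` to `0`. -/
def smooth (S : Finset X) : HalfEdge X J → HalfEdge X J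
  | .inl (x, i) => if x ∈ S then .inl (x, ![3, 2, 1, 0] i) else .inl (x, ![1, 0, 3, 2] i)
  | .inr (j, i) => .inr (j, i + 1)

/-- The circles of the resolution `L_S`: the classes of half-edges under following the strands. -/
def Circle (D : LinkDiagram X J F) (S : Finset X) : Type _ :=
  Quot fun h k : HalfEdge X J => k = D.glue h ∨ k = smooth S h

/-- The circle of `L_S` through a half-edge. -/
def circleOf (D : LinkDiagram X J F) (S : Finset X) (h : HalfEdge X J) : D.Circle S :=
  Quot.mk _ h

/-- The circle of `L_S` containing the marked point. -/
def markedCircle (D : LinkDiagram X J F) (S : Finset X) : D.Circle S :=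
  D.circleOf S D.mark

/-- The unmarked circles of `L_S`. -/
def Unmarked (D : LinkDiagram X J F) (S : Finset X) : Type _ :=
  {C : D.Circle S // C ≠ D.markedCircle S}

instance (D : LinkDiagram X J F) (S : Finset X) : Finite (D.Circle S) :=
  inferInstanceAs (Finite (Quot _))

instance (D : LinkDiagram X J F) (S : Finset X) : Finite (D.Unmarked S) :=
  inferInstanceAs (Finite {C : D.Circle S // C ≠ D.markedCircle S})

noncomputable instance (D : LinkDiagram X J F) (S : Finset X) : Fintype (D.Unmarked S) :=
  Fintype.ofFinite _

noncomputable instance (D : LinkDiagram X J F) (S : Finset X) : DecidableEq (D.Unmarked S) :=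
  Classical.decEq _

/-- Two faces of `L_S` touch in the complement of the circle `C`: they are the two sides of an edge
that is not part of `C`, or the two sides of the arc that decorates a resolved crossing. -/
def Touch (D : LinkDiagram X J F) (S : Finset X) (C : D.Circle S) (f g : F) : Prop :=
  (∃ h, D.circleOf S h ≠ C ∧ f = D.face h ∧ g = D.face (D.glue h)) ∨
  (∃ x, x ∉ S ∧ f = D.face (.inl (x, 1)) ∧ g = D.face (.inl (x, 3))) ∨
  (∃ x, x ∈ S ∧ f = D.face (.inl (x, 0)) ∧ g = D.face (.inl (x, 2)))

/-- The components of `S² ∖ C`. -/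
def Side (D : LinkDiagram X J F) (S : Finset X) (C : D.Circle S) : Type _ :=
  Quot (D.Touch S C)

/-- The component of `S² ∖ C` containing a face. -/
def sideOf (D : LinkDiagram X J F) (S : Finset X) (C : D.Circle S) (f : F) : D.Side S C :=
  Quot.mk _ f

open Classical in
/-- The faces in the interior of an unmarked circle `C`, that is, in the component of `S² ∖ C` which
does not contain the marked point. (The marked point and the faces on either side of its edge lie in
the same component, since its edge is not part of `C`.) -/
noncomputable def interior (D : LinkDiagram X J F) (S : Finset X) (C : D.Unmarked S) : Finset F :=
  {f | D.sideOf S C.1 f ≠ D.sideOf S C.1 (D.face D.mark)}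

/-- The polynomial ring over `ℤ/2` with one variable for each face. -/
abbrev FaceRing (F : Type*) := MvPolynomial F (ZMod 2)

/-- The formal area `[C]` of an unmarked circle. -/
noncomputable def area (D : LinkDiagram X J F) (S : Finset X) (C : D.Unmarked S) : FaceRing F :=
  ∑ f ∈ D.interior S C, MvPolynomial.X f

/-- A pure state: a sign on every unmarked circle of `L_S`. -/
abbrev PureState (D : LinkDiagram X J F) (S : Finset X) := D.Unmarked S → Sgn

/-- The module `V(L_S) = R v₀ ⊗ K([C₁], …, [C_k])`, with the rank one factor `R v₀` of the marked
circle left implicit. -/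
abbrev V (D : LinkDiagram X J F) (S : Finset X) := Koszul (FaceRing F) (D.Unmarked S)

/-- The Koszul differential on `V(L_S)`. -/
noncomputable def dV (D : LinkDiagram X J F) (S : Finset X) : D.V S →ₗ[FaceRing F] D.V S :=
  koszulD (D.area S)

open Classical in
/-- The basis vector that a pure state puts on a circle, with `v₀` on the marked one. -/
noncomputable def label (D : LinkDiagram X J F) {S : Finset X} (s : D.PureState S)
    (C : D.Circle S) : Label :=
  if h : C = D.markedCircle S then none else some (s ⟨C, h⟩)

/-- The two strands of `L_S` at the crossing `x` lie on the circles `strandA` and `strandB`, which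
may coincide. -/
def strandA (D : LinkDiagram X J F) (S : Finset X) (x : X) : D.Circle S :=
  D.circleOf S (.inl (x, 0))

/-- See `strandA`. -/
def strandB (D : LinkDiagram X J F) (S : Finset X) (x : X) : D.Circle S :=
  D.circleOf S (.inl (x, 2))

/-- The pure state `t` of `L_{S ∪ {x}}` occurs in the image of the pure state `s` of `L_S` under the
Khovanov map: the circles away from `x` keep their labels, and at `x` one uses `μ` if two circles of
`L_S` meet there (they merge), and `Δ` if there is only one (it divides). -/
def Occurs (D : LinkDiagram X J F) (S : Finset X) (x : X) (s : D.PureState S)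
    (t : D.PureState (insert x S)) : Prop :=
  (∀ h, D.circleOf S h ≠ D.strandA S x → D.circleOf S h ≠ D.strandB S x →
    D.label t (D.circleOf (insert x S) h) = D.label s (D.circleOf S h)) ∧
  (D.strandA S x ≠ D.strandB S x →
    D.label t (D.strandA (insert x S) x) ∈
      mu (D.label s (D.strandA S x)) (D.label s (D.strandB S x))) ∧
  (D.strandA S x = D.strandB S x →
    (D.label t (D.strandA (insert x S) x), D.label t (D.strandB (insert x S) x)) ∈
      delta (D.label s (D.strandA S x)))

open Classical in
/-- The component `V(L_S) → V(L_{S ∪ {x}})` of the Khovanov differential, for `x ∉ S`. -/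
noncomputable def edgeMap (D : LinkDiagram X J F) (S : Finset X) (x : X) :
    D.V S →ₗ[FaceRing F] D.V (insert x S) :=
  Finsupp.linearCombination (FaceRing F) fun s : D.PureState S =>
    ∑ t : D.PureState (insert x S), if D.Occurs S x s t then Finsupp.single t 1 else 0

open scoped DirectSum

/-- The module of the unshifted totally twisted Khovanov complex. -/
abbrev KT (D : LinkDiagram X J F) := ⨁ S : Finset X, D.V S

/-- The Khovanov differential. -/
noncomputable def dKH (D : LinkDiagram X J F) : D.KT →ₗ[FaceRing F] D.KT :=
  DirectSum.toModule (FaceRing F) (Finset X) D.KT fun S =>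
    ∑ x ∈ Sᶜ, DirectSum.lof (FaceRing F) (Finset X) (fun S => D.V S) (insert x S) ∘ₗ D.edgeMap S x

/-- The sum of the Koszul differentials of all resolutions. -/
noncomputable def dKoszul (D : LinkDiagram X J F) : D.KT →ₗ[FaceRing F] D.KT :=
  DirectSum.toModule (FaceRing F) (Finset X) D.KT fun S =>
    DirectSum.lof (FaceRing F) (Finset X) (fun S => D.V S) S ∘ₗ D.dV S

/-- The `q`-grading of a pure state in `V(L_S){|S|}`. -/
noncomputable def qDeg (D : LinkDiagram X J F) {S : Finset X} (s : D.PureState S) : ℤ :=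
  ∑ C, (s C).deg + (S.card : ℤ)

/-- The part of `h`-grading `i` and `q`-grading `j`. -/
noncomputable def bigraded (D : LinkDiagram X J F) (i j : ℤ) : Submodule (FaceRing F) D.KT :=
  Submodule.span (FaceRing F) {v | ∃ (S : Finset X) (s : D.PureState S),
    (S.card : ℤ) = i ∧ D.qDeg s = j ∧
    v = DirectSum.lof (FaceRing F) (Finset X) (fun S => D.V S) S (Finsupp.single s 1)}

end LinkDiagram

end TotallyTwisted

namespace TotallyTwisted

/-! All the topology comes from one fact, `exists_potential`: over `ℤ/2`, every cycle in the graph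
drawn on the sphere bounds a set of faces. This is a dimension count with Euler's formula.

Applied to a circle `C` of a resolution, it gives a function `χ` on faces that jumps exactly across
`C`. Since `C` has exactly two sides, `χ`, normalised to vanish next to the marked point, is the
indicator of the interior, so `[C] = ∑ χ(f) x_f`. This expression is additive in the edge set of
`C`, so areas add when circles merge or divide (`area_eq_add`).

Applied to the constant function `1`, which is a cycle because all vertices have even valence, it
gives a checkerboard colouring. Strands respect the colouring, so a strand leaving a crossing first
returns to it at a half-edge of the other colour, never at the opposite half-edge. Therefore
changing one smoothing always merges two circles or divides one (`strands_merge_or_divide`). The two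
cases are inverse to each other, and the relation `Merges`, read in either direction, covers both.

The algebra rests on the operator `circleOp`: `v₊ ↦ v₋`, `v₋ ↦ 0`, `v₀ ↦ 0` on a single circle. The
Koszul differential is the sum of these operators weighted by the areas. A Khovanov edge map
intertwines the operators of the circles through any fixed half-edge before and after the change
(`edgeMap_circleOp`). With additivity of areas this makes the edge maps chain maps
(`edgeMap_comp_dV`).

Every pure state is obtained from the all-`v₊` state by such operators, so commutation of the edge
maps (`crossingOp_comm`) and their bidegree need to be checked only there. A merge sends this state
to the all-`v₊` state; a division sends it to the sum of the operators of the two new circles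
applied to the all-`v₊` state. Finally, in characteristic two a sum of commuting square-zero maps
squares to zero. -/

/-- A function to `ℤ/2` that is invariant under a fixed point free involution has sum zero. -/
theorem sum_eq_zero_of_involution {H : Type*} [Fintype H] (σ : H → H) (hσ : ∀ h, σ (σ h) = h)
    (hne : ∀ h, σ h ≠ h) (f : H → ZMod 2) (hf : ∀ h, f (σ h) = f h) : ∑ h, f h = 0 :=
  Finset.sum_involution (fun h _ => σ h)
    (fun h _ => by rw [hf]; exact CharTwo.add_self_eq_zero _)
    (fun h _ _ => hne h) (fun h _ => Finset.mem_univ _) (fun h _ => hσ h)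

/-! ### Rotations and smoothings of half-edges -/

section Rotation

variable {X J : Type*}

/-- Rotation by one half-edge, as a permutation. -/
def rotPerm (X J : Type*) : Equiv.Perm (HalfEdge X J) :=
  Equiv.sumCongr (Equiv.prodCongr (Equiv.refl X) (Equiv.addRight 1))
    (Equiv.prodCongr (Equiv.refl J) (Equiv.addRight 1))

theorem rotPerm_apply (h : HalfEdge X J) : rotPerm X J h = rot h := by
  rcases h with ⟨x, i⟩ | ⟨j, i⟩ <;> rfl

end Rotation

namespace LinkDiagram

section Smoothing

variable {X J : Type*} [DecidableEq X]

theorem smooth_smooth (S : Finset X) (h : HalfEdge X J) : smooth S (smooth S h) = h := by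
  rcases h with ⟨x, i⟩ | ⟨j, i⟩
  · by_cases hx : x ∈ S <;> fin_cases i <;> simp [smooth, hx]
  · fin_cases i <;> simp [smooth]

theorem smooth_ne (S : Finset X) (h : HalfEdge X J) : smooth S h ≠ h := by
  rcases h with ⟨x, i⟩ | ⟨j, i⟩
  · by_cases hx : x ∈ S <;> fin_cases i <;> simp [smooth, hx]
  · fin_cases i <;> simp [smooth]

/-- A smoothing moves a half-edge by an odd number of rotations. -/
theorem apply_smooth_of_rot {A : Type*} (S : Finset X) (σ : A → A) (hσ : ∀ a, σ (σ a) = a)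
    (o : HalfEdge X J → A) (ho : ∀ h, o (rot h) = σ (o h)) (h : HalfEdge X J) :
    o (smooth S h) = σ (o h) := by
  have ho' : ∀ h, o h = σ (o (rot h)) := fun h => by rw [ho, hσ]
  rcases h with ⟨x, i⟩ | ⟨j, i⟩
  · have e0 := ho (.inl (x, 0))
    have e1 := ho (.inl (x, 1))
    have e2 := ho (.inl (x, 2))
    have e3 := ho (.inl (x, 3))
    simp only [rot, Fin.isValue, zero_add, Fin.reduceAdd] at e0 e1 e2 e3
    have h1 := hσ (o (.inl (x, 0)))
    have h2 := hσ (o (.inl (x, 1)))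
    by_cases hx : x ∈ S <;> fin_cases i <;> simp only [smooth, hx, if_true, if_false] <;>
      simp <;> grind
  · exact ho (.inr (j, i))

end Smoothing

/-! ### Homology of the sphere modulo two -/

section Potential

variable {X J F : Type*} [Fintype X] [Fintype J] [Fintype F] (D : LinkDiagram X J F)

open Module

/-- Functions on half-edges invariant under `σ`. -/
def invariants {H : Type*} (σ : H → H) : Submodule (ZMod 2) (H → ZMod 2) where
  carrier := {u | ∀ h, u (σ h) = u h}
  add_mem' ha hb h := by simp [ha h, hb h]
  zero_mem' h := rfl
  smul_mem' c u hu h := by simp [hu h]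

/-- In characteristic two both the kernel and the range of `1 + σ*` consist of invariant functions,
so rank-nullity gives the bound. For `glue` it says that the invariants have dimension at least the
number of edges. -/
theorem card_le_two_mul_finrank_invariants {H : Type*} [Fintype H] (σ : H → H)
    (hσ : ∀ h, σ (σ h) = h) :
    Fintype.card H ≤ 2 * finrank (ZMod 2) (invariants σ) := by
  let φ : (H → ZMod 2) →ₗ[ZMod 2] (H → ZMod 2) := LinearMap.id + LinearMap.funLeft _ _ σ
  have hker : LinearMap.ker φ ≤ invariants σ := fun u hu h => by
    have := congrFun (LinearMap.mem_ker.1 hu) h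
    simp only [φ, LinearMap.add_apply, LinearMap.id_apply, Pi.add_apply,
      LinearMap.funLeft_apply, Pi.zero_apply] at this
    exact (CharTwo.add_eq_zero.1 this).symm
  have hrange : LinearMap.range φ ≤ invariants σ := by
    rintro _ ⟨u, rfl⟩ h
    simp [φ, LinearMap.funLeft_apply, hσ, add_comm]
  have := LinearMap.finrank_range_add_finrank_ker φ
  have h1 := Submodule.finrank_mono hker
  have h2 := Submodule.finrank_mono hrange
  rw [finrank_fintype_fun_eq_card] at this
  omega

/-- Functions on the vertices pull back injectively to rotation-invariant functions. -/
theorem card_le_finrank_invariants_rot :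
    Fintype.card X + Fintype.card J
      ≤ finrank (ZMod 2) (invariants (rot : HalfEdge X J → HalfEdge X J)) := by
  let φ : (X ⊕ J → ZMod 2) →ₗ[ZMod 2] (HalfEdge X J → ZMod 2) :=
    LinearMap.funLeft _ _ (Sum.map Prod.fst Prod.fst)
  have hφ : Function.Injective φ := LinearMap.funLeft_injective_of_surjective _ _ _ <|
    Sum.map_surjective.2 ⟨fun x => ⟨(x, 0), rfl⟩, fun j => ⟨(j, 0), rfl⟩⟩
  have hrange : LinearMap.range φ ≤ invariants (rot : HalfEdge X J → HalfEdge X J) := by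
    rintro _ ⟨u, rfl⟩ (⟨x, i⟩ | ⟨j, i⟩) <;> rfl
  have h1 := Submodule.finrank_mono hrange
  rw [LinearMap.finrank_range_of_inj hφ, finrank_fintype_fun_eq_card, Fintype.card_sum] at h1
  exact h1

/-- A function invariant under both maps descends to the connected components of the graph. -/
theorem finrank_invariants_inf_le :
    finrank (ZMod 2) (invariants D.glue ⊓ invariants rot : Submodule _ _)
      ≤ Nat.card (Quot fun h k : HalfEdge X J => k = D.glue h ∨ k = rot h) := by
  classical
  let Q := Quot fun h k : HalfEdge X J => k = D.glue h ∨ k = rot h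
  have : Fintype Q := Fintype.ofFinite _
  let φ : (Q → ZMod 2) →ₗ[ZMod 2] (HalfEdge X J → ZMod 2) := LinearMap.funLeft _ _ (Quot.mk _)
  have hle : (invariants D.glue ⊓ invariants rot : Submodule _ _) ≤ LinearMap.range φ := by
    rintro u ⟨h1, h2⟩
    refine ⟨Quot.lift u ?_, rfl⟩
    rintro h k (rfl | rfl)
    · exact (h1 h).symm
    · exact (h2 h).symm
  have h1 := (Submodule.finrank_mono hle).trans (LinearMap.finrank_range_le φ)
  rw [finrank_fintype_fun_eq_card, ← Nat.card_eq_fintype_card] at h1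
  exact h1

/-- The coboundary of a function on faces. -/
def faceCoboundary : (F → ZMod 2) →ₗ[ZMod 2] (HalfEdge X J → ZMod 2) :=
  LinearMap.funLeft _ _ D.face + LinearMap.funLeft _ _ (D.face ∘ D.glue)

theorem faceCoboundary_apply (χ : F → ZMod 2) (h : HalfEdge X J) :
    D.faceCoboundary χ h = χ (D.face h) + χ (D.face (D.glue h)) := rfl

/-- Because the surface is connected, only constant functions have zero coboundary; the kernel has
dimension at most one. -/
theorem card_le_finrank_range_faceCoboundary :
    Fintype.card F ≤ finrank (ZMod 2) (LinearMap.range D.faceCoboundary) + 1 := by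
  have hker : LinearMap.ker D.faceCoboundary ≤ Submodule.span (ZMod 2) {fun _ => 1} := by
    intro χ hχ
    have key : ∀ f g, χ f = χ g := by
      have hc : ∀ f g, (∃ h, f = D.face h ∧ g = D.face (D.glue h)) → χ f = χ g := by
        rintro _ _ ⟨h, rfl, rfl⟩
        exact CharTwo.add_eq_zero.1 (congrFun (LinearMap.mem_ker.1 hχ) h)
      intro f g
      exact congrArg (Quot.lift χ hc) (D.surface_connected.elim (Quot.mk _ f) (Quot.mk _ g))
    refine Submodule.mem_span_singleton.2 ⟨χ (D.face D.mark), ?_⟩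
    ext f
    simp [key f (D.face D.mark)]
  have h1 := (Submodule.finrank_mono hker).trans (finrank_span_le_card _)
  have h2 := LinearMap.finrank_range_add_finrank_ker D.faceCoboundary
  rw [finrank_fintype_fun_eq_card] at h2
  simp only [Set.toFinset_singleton, Finset.card_singleton] at h1
  omega

/-- On the sphere every cycle with coefficients in `ℤ/2` is a boundary. -/
theorem exists_potential (w : HalfEdge X J → ZMod 2) (hglue : ∀ h, w (D.glue h) = w h)
    (hrot : ∀ u ∈ invariants (rot : HalfEdge X J → HalfEdge X J), ∑ h, u h * w h = 0) :
    ∃ χ : F → ZMod 2, ∀ h, χ (D.face h) + χ (D.face (D.glue h)) = w h := by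
  classical
  let B := dotProductBilin (ZMod 2) (ZMod 2) (m := HalfEdge X J) (A := ZMod 2)
  let W : Submodule (ZMod 2) (HalfEdge X J → ZMod 2) := invariants D.glue ⊔ invariants rot
  -- The orthogonal complement of `W` contains all cycles. This is used twice: for coboundaries of
  -- functions on faces and for the given `w`.
  have hperp : ∀ w : HalfEdge X J → ZMod 2, (∀ h, w (D.glue h) = w h) →
      (∀ u ∈ invariants (rot : HalfEdge X J → HalfEdge X J), ∑ h, u h * w h = 0) →
      w ∈ LinearMap.BilinForm.orthogonal B W := by
    intro w hglue hrot u hu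
    obtain ⟨a, ha, b, hb, rfl⟩ := Submodule.mem_sup.1 hu
    have h1 : ∑ h, a h * w h = 0 := sum_eq_zero_of_involution D.glue D.glue_glue D.glue_ne _
      fun h => by rw [hglue, ha h]
    have h2 := hrot b hb
    change (a + b) ⬝ᵥ w = 0
    rw [add_dotProduct]
    simp only [dotProduct, h1, h2, add_zero]
  have hle : LinearMap.range D.faceCoboundary ≤ LinearMap.BilinForm.orthogonal B W := by
    rintro _ ⟨χ, rfl⟩
    refine hperp _ (fun h => ?_) fun u hu => ?_
    · rw [faceCoboundary_apply, faceCoboundary_apply, D.glue_glue, add_comm]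
    · simp only [faceCoboundary_apply, mul_add, Finset.sum_add_distrib]
      -- Reindexing by `rot` turns the second sum into the first, since the right side of `rot h` is
      -- the left side of `h`; the two copies cancel.
      rw [← Equiv.sum_comp (rotPerm X J) fun h => u h * χ (D.face (D.glue h))]
      simp only [rotPerm_apply, D.face_glue_rot, hu _]
      exact CharTwo.add_self_eq_zero _
  have hnd : B.Nondegenerate :=
    ⟨fun v hv => dotProduct_eq_zero v hv,
      fun v hv => dotProduct_eq_zero v fun u => (dotProduct_comm v u).trans (hv u)⟩
  have e1 := LinearMap.BilinForm.finrank_orthogonal (B := B) hnd W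
  have e2 : finrank (ZMod 2) W + _ = _ := Submodule.finrank_sup_add_finrank_inf_eq (invariants D.glue)
    (invariants (rot : HalfEdge X J → HalfEdge X J))
  have e3 := card_le_two_mul_finrank_invariants D.glue D.glue_glue
  have e4 := card_le_finrank_invariants_rot (X := X) (J := J)
  have e5 := D.finrank_invariants_inf_le
  have e6 := D.card_le_finrank_range_faceCoboundary
  have e7 := D.euler
  rw [finrank_fintype_fun_eq_card] at e1
  simp only [Fintype.card_sum, Fintype.card_prod, Fintype.card_fin] at e1 e3
  -- With `c` components, `dim W ≥ E + V - c`. As there are `2E` half-edges, the complement of `W`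
  -- has dimension at most `E - V + c = F - 1`, which the range of the coboundary already attains.
  have : LinearMap.range D.faceCoboundary = LinearMap.BilinForm.orthogonal B W :=
    Submodule.eq_of_le_of_finrank_le hle (by omega)
  obtain ⟨χ, hχ⟩ := this ▸ hperp w hglue hrot
  exact ⟨χ, fun h => congrFun hχ h⟩

end Potential

end LinkDiagram
end TotallyTwisted

namespace TotallyTwisted
namespace LinkDiagram

/-! ### The two sides of a circle, and its area -/

section Interior

variable {X J F : Type*} [Fintype X] [Fintype J] [Fintype F] [DecidableEq X]
  (D : LinkDiagram X J F) (S : Finset X)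

theorem circleOf_glue (h : HalfEdge X J) : D.circleOf S (D.glue h) = D.circleOf S h :=
  (Quot.sound (r := fun h k => k = D.glue h ∨ k = smooth S h) (Or.inl rfl)).symm

theorem circleOf_smooth (h : HalfEdge X J) : D.circleOf S (smooth S h) = D.circleOf S h :=
  (Quot.sound (r := fun h k => k = D.glue h ∨ k = smooth S h) (Or.inr rfl)).symm

theorem exists_circleOf_eq (C : D.Circle S) : ∃ h, D.circleOf S h = C := Quot.exists_rep C

/-- A function of half-edges that is invariant along the strands is constant on circles. -/
theorem eq_of_circleOf_eq {A : Type*} {S : Finset X} (f : HalfEdge X J → A)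
    (hg : ∀ h, f (D.glue h) = f h)
    (hs : ∀ h, f (smooth S h) = f h) {h k : HalfEdge X J}
    (hk : D.circleOf S h = D.circleOf S k) : f h = f k := by
  refine congrArg (Quot.lift f ?_) hk
  rintro a b (rfl | rfl)
  · exact (hg a).symm
  · exact (hs a).symm

open Classical in
/-- The edges of a circle, as a function to `ℤ/2`. -/
noncomputable def circleIndicator (C : D.Circle S) (h : HalfEdge X J) : ZMod 2 :=
  if D.circleOf S h = C then 1 else 0

/-- A potential of the circle `C`: a function on faces that jumps precisely at the edges of `C`. -/
def IsPotential (C : D.Circle S) (χ : F → ZMod 2) : Prop :=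
  ∀ h, χ (D.face h) + χ (D.face (D.glue h)) = D.circleIndicator S C h

/-- A smoothing pairs the half-edges at each vertex, and `u * w` takes equal values on a pair. Thus
any function constant along strands satisfies the cycle condition at the vertices. -/
theorem sum_mul_eq_zero_of_smooth (w : HalfEdge X J → ZMod 2) (hw : ∀ h, w (smooth S h) = w h)
    (u : HalfEdge X J → ZMod 2) (hu : u ∈ invariants (rot : HalfEdge X J → HalfEdge X J)) :
    ∑ h, u h * w h = 0 :=
  sum_eq_zero_of_involution (smooth S) (smooth_smooth S) (smooth_ne S) _ fun h => by
    rw [hw, apply_smooth_of_rot S id (fun _ => rfl) u hu]; rfl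

/-- The edges of a circle form a cycle, and adding a constant to a potential normalises it at the
marked point. -/
theorem exists_isPotential (C : D.Circle S) :
    ∃ χ, D.IsPotential S C χ ∧ χ (D.face D.mark) = 0 := by
  obtain ⟨χ, hχ⟩ := D.exists_potential (D.circleIndicator S C)
    (fun h => by rw [circleIndicator, circleOf_glue, circleIndicator])
    (sum_mul_eq_zero_of_smooth S _ fun h => by
      rw [circleIndicator, circleOf_smooth, circleIndicator])
  refine ⟨fun f => χ f + χ (D.face D.mark), fun h => ?_, CharTwo.add_self_eq_zero _⟩
  rw [← hχ h]
  linear_combination CharTwo.add_self_eq_zero (χ (D.face D.mark))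

theorem IsPotential.face_rot {D : LinkDiagram X J F} {S : Finset X} {C : D.Circle S}
    {χ : F → ZMod 2} (hχ : D.IsPotential S C χ)
    (h : HalfEdge X J) : χ (D.face (rot h)) = χ (D.face h) + D.circleIndicator S C (rot h) := by
  rw [← hχ, D.face_glue_rot]
  linear_combination - CharTwo.add_self_eq_zero (χ (D.face h))

/-- An edge off `C` causes no jump. Turning about a crossing from one end of its decorating arc to
the other passes two half-edges of the same strand, whose jumps agree and cancel. -/
theorem IsPotential.eq_of_touch {D : LinkDiagram X J F} {S : Finset X} {C : D.Circle S}
    {χ : F → ZMod 2} (hχ : D.IsPotential S C χ)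
    {f g : F} (hfg : D.Touch S C f g) : χ f = χ g := by
  have two : ∀ h, D.circleOf S (rot h) = D.circleOf S (rot (rot h)) →
      χ (D.face h) = χ (D.face (rot (rot h))) := fun h hh => by
    rw [hχ.face_rot, hχ.face_rot, circleIndicator, circleIndicator, hh, add_assoc,
      CharTwo.add_self_eq_zero, add_zero]
  rcases hfg with ⟨h, hh, rfl, rfl⟩ | ⟨x, hx, rfl, rfl⟩ | ⟨x, hx, rfl, rfl⟩
  · have := hχ h
    rw [circleIndicator, if_neg hh] at this
    exact CharTwo.add_eq_zero.1 this
  · refine two (.inl (x, 1)) ?_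
    have := D.circleOf_smooth S (.inl (x, 2))
    simpa [smooth, hx, rot] using this.symm
  · refine two (.inl (x, 0)) ?_
    have := D.circleOf_smooth S (.inl (x, 1))
    simpa [smooth, hx, rot] using this.symm

/-- Walking along the strands, the left hand side does not change. -/
theorem sideOf_face_smooth (C : D.Circle S) (h : HalfEdge X J) :
    D.sideOf S C (D.face (smooth S h)) = D.sideOf S C (D.face (D.glue h)) := by
  rcases h with ⟨x, i⟩ | ⟨j, i⟩
  · have e0 := D.face_glue_rot (.inl (x, 0))
    have e1 := D.face_glue_rot (.inl (x, 1))
    have e2 := D.face_glue_rot (.inl (x, 2))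
    have e3 := D.face_glue_rot (.inl (x, 3))
    simp only [rot, Fin.isValue, zero_add, Fin.reduceAdd] at e0 e1 e2 e3
    by_cases hx : x ∈ S
    · have t : D.sideOf S C _ = D.sideOf S C _ := Quot.sound (Or.inr (Or.inr ⟨x, hx, rfl, rfl⟩))
      fin_cases i <;> simp [smooth, hx, e0, e1, e2, e3, t]
    · have t : D.sideOf S C _ = D.sideOf S C _ := Quot.sound (Or.inr (Or.inl ⟨x, hx, rfl, rfl⟩))
      fin_cases i <;> simp [smooth, hx, e0, e1, e2, e3, t]
  · have e := D.face_glue_rot (.inr (j, i + 1))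
    rw [show rot (.inr (j, i + 1) : HalfEdge X J) = .inr (j, i) by
      fin_cases i <;> rfl] at e
    rw [e]; rfl

/-- The two sides of a circle: a circle has at most two sides. -/
theorem sideOf_eq_or (h₀ : HalfEdge X J) (f : F) :
    D.sideOf S (D.circleOf S h₀) f = D.sideOf S (D.circleOf S h₀) (D.face h₀) ∨
    D.sideOf S (D.circleOf S h₀) f = D.sideOf S (D.circleOf S h₀) (D.face (D.glue h₀)) := by
  set C := D.circleOf S h₀ with hC
  let side : HalfEdge X J → D.Side S C := fun h => D.sideOf S C (D.face h)
  let P : HalfEdge X J → Sym2 (D.Side S C) := fun h => s(side h, side (D.glue h))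
  -- The unordered pair of sides adjacent to an edge is constant along `C`; it has to be unordered
  -- because `glue` and `smooth` both swap left and right.
  have hP : ∀ {h}, D.circleOf S h = C → P h = P h₀ := fun {h} hh =>
    D.eq_of_circleOf_eq P
      (fun h => by simp only [P, D.glue_glue]; exact Sym2.eq_swap)
      (fun h => by
        have e1 : side (smooth S h) = side (D.glue h) := D.sideOf_face_smooth S C h
        have e2 : side h = side (D.glue (smooth S h)) := by
          have := D.sideOf_face_smooth S C (smooth S h)
          rwa [smooth_smooth] at this
        simp only [P, e1, ← e2]
        exact Sym2.eq_swap) hh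
  -- Crossing any edge, on `C` or not, never leaves the two sides at `h₀`. Connectedness of the
  -- surface then reaches every face.
  have hmem : ∀ h, side h ∈ P h₀ ↔ side (D.glue h) ∈ P h₀ := fun h => by
    by_cases hh : D.circleOf S h = C
    · rw [← hP hh]
      exact ⟨fun _ => Sym2.mem_mk_right _ _, fun _ => Sym2.mem_mk_left _ _⟩
    · rw [show side h = side (D.glue h) from Quot.sound (Or.inl ⟨h, hh, rfl, rfl⟩)]
  have hc : ∀ f g, (∃ h, f = D.face h ∧ g = D.face (D.glue h)) →
      (D.sideOf S C f ∈ P h₀) = (D.sideOf S C g ∈ P h₀) := by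
    rintro _ _ ⟨h, rfl, rfl⟩
    exact propext (hmem h)
  have := congrArg (Quot.lift (fun f => D.sideOf S C f ∈ P h₀) hc)
    (D.surface_connected.elim (Quot.mk _ (D.face h₀)) (Quot.mk _ f))
  exact Sym2.mem_iff.1 (this.mp (Sym2.mem_mk_left _ _))

/-- A form of the Jordan curve theorem: there are at most two sides by `sideOf_eq_or`, and `χ`
separates them because it jumps at an edge of the circle. -/
theorem IsPotential.sideOf_eq_iff {D : LinkDiagram X J F} {S : Finset X} {C : D.Circle S}
    {χ : F → ZMod 2} (hχ : D.IsPotential S C χ)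
    (f g : F) : D.sideOf S C f = D.sideOf S C g ↔ χ f = χ g := by
  have hlift : ∀ {f g}, D.sideOf S C f = D.sideOf S C g → χ f = χ g := fun h =>
    congrArg (Quot.lift χ fun _ _ => hχ.eq_of_touch) h
  refine ⟨hlift, fun h => ?_⟩
  obtain ⟨h₀, rfl⟩ := D.exists_circleOf_eq S C
  have hne : χ (D.face h₀) ≠ χ (D.face (D.glue h₀)) := fun e => by
    have := hχ h₀
    rw [circleIndicator, if_pos rfl, e, CharTwo.add_self_eq_zero] at this
    exact zero_ne_one this
  rcases D.sideOf_eq_or S h₀ f with hf | hf <;> rcases D.sideOf_eq_or S h₀ g with hg | hg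
  · rw [hf, hg]
  · exact absurd ((hlift hf).symm.trans (h.trans (hlift hg))) hne
  · exact absurd ((hlift hg).symm.trans (h.symm.trans (hlift hf))) hne
  · rw [hf, hg]

theorem area_eq_of_isPotential (C : D.Unmarked S) (χ : F → ZMod 2) (hχ : D.IsPotential S C.1 χ)
    (hmark : χ (D.face D.mark) = 0) :
    D.area S C = ∑ f, MvPolynomial.C (χ f) * MvPolynomial.X f := by
  classical
  rw [area, interior, Finset.sum_filter]
  refine Finset.sum_congr rfl fun f _ => ?_
  simp only [ne_eq, hχ.sideOf_eq_iff, hmark]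
  rcases (by decide : ∀ a : ZMod 2, a = 0 ∨ a = 1) (χ f) with h | h <;> simp [h]

/-- If the edges of one circle are those of two others, then the areas add up. -/
theorem area_eq_add {S₀ S₁ S₂ : Finset X} (C₀ : D.Unmarked S₀) (C₁ : D.Unmarked S₁)
    (C₂ : D.Unmarked S₂) (h : ∀ h, D.circleIndicator S₀ C₀.1 h
      = D.circleIndicator S₁ C₁.1 h + D.circleIndicator S₂ C₂.1 h) :
    D.area S₀ C₀ = D.area S₁ C₁ + D.area S₂ C₂ := by
  obtain ⟨χ₁, h₁, m₁⟩ := D.exists_isPotential S₁ C₁.1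
  obtain ⟨χ₂, h₂, m₂⟩ := D.exists_isPotential S₂ C₂.1
  rw [D.area_eq_of_isPotential S₁ C₁ χ₁ h₁ m₁, D.area_eq_of_isPotential S₂ C₂ χ₂ h₂ m₂,
    D.area_eq_of_isPotential S₀ C₀ (χ₁ + χ₂)
      (fun k => by rw [h k, ← h₁ k, ← h₂ k]; simp only [Pi.add_apply]; ring)
      (by simp [m₁, m₂]), ← Finset.sum_add_distrib]
  simp [add_mul]

end Interior

/-! ### Changing one smoothing: merging and dividing -/

section Smoothing

variable {X J : Type*} [DecidableEq X]

/-- Two resolutions differ precisely at the crossing `x`. -/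
def DifferAt (S S' : Finset X) (x : X) : Prop :=
  (x ∈ S ↔ x ∉ S') ∧ ∀ y, y ≠ x → (y ∈ S ↔ y ∈ S')

theorem differAt_insert {S : Finset X} {x : X} (hx : x ∉ S) : DifferAt S (insert x S) x :=
  ⟨by simp [hx], fun y hy => by simp [hy]⟩

theorem DifferAt.symm {S S' : Finset X} {x : X} (h : DifferAt S S' x) : DifferAt S' S x :=
  ⟨by have := h.1; tauto, fun y hy => (h.2 y hy).symm⟩

theorem DifferAt.smooth_eq {S S' : Finset X} {x : X} (hd : DifferAt S S' x) {h : HalfEdge X J}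
    (hh : ∀ i, h ≠ .inl (x, i)) : smooth S' h = smooth S h := by
  rcases h with ⟨y, i⟩ | ⟨j, i⟩
  · have hy : y ≠ x := by rintro rfl; exact hh i rfl
    simp only [smooth, hd.2 y hy]
  · rfl

theorem exists_smooth_eq (S : Finset X) (x : X) (i : Fin 4) :
    ∃ k, smooth S (.inl (x, i) : HalfEdge X J) = .inl (x, k) := by
  by_cases hx : x ∈ S <;> simp [smooth, hx]

end Smoothing

section Strands

variable {X J F : Type*} [Fintype X] [Fintype J] [Fintype F] [DecidableEq X]
  (D : LinkDiagram X J F)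

/-- The checkerboard colouring. -/
theorem exists_coloring : ∃ o : HalfEdge X J → ZMod 2,
    (∀ h, o (D.glue h) = o h + 1) ∧ ∀ h, o (rot h) = o h + 1 := by
  -- The constant `1` is a cycle since every vertex has even valence; the smoothing `∅` serves only
  -- to pair up the half-edges.
  obtain ⟨χ, hχ⟩ := D.exists_potential (fun _ => 1) (fun _ => rfl)
    (sum_mul_eq_zero_of_smooth ∅ _ fun h => rfl)
  have hg : ∀ h, χ (D.face (D.glue h)) = χ (D.face h) + 1 := fun h => by
    rw [← hχ h]
    linear_combination - CharTwo.add_self_eq_zero (χ (D.face h))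
  refine ⟨fun h => χ (D.face h), hg, fun h => ?_⟩
  have := hg (rot h)
  rw [D.face_glue_rot] at this
  change χ (D.face (rot h)) = χ (D.face h) + 1
  rw [this, add_assoc, CharTwo.add_self_eq_zero, add_zero]

/-- Starting at a half-edge of the crossing `x` and following the strands until one returns to `x`,
one arrives at a half-edge of the other colour. -/
theorem exists_path (S : Finset X) (x : X) (i : Fin 4) (o : HalfEdge X J → ZMod 2)
    (hg : ∀ h, o (D.glue h) = o h + 1) (hr : ∀ h, o (rot h) = o h + 1) :
    ∃ j, o (.inl (x, j)) = o (.inl (x, i)) + 1 ∧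
      ∃ T : Set (HalfEdge X J), (∀ k, .inl (x, k) ∈ T ↔ k = i ∨ k = j) ∧
        (∀ h ∈ T, D.glue h ∈ T) ∧ (∀ h ∈ T, (∀ k, h ≠ .inl (x, k)) → smooth S h ∈ T) ∧
        ∀ S' : Finset X, (∀ h : HalfEdge X J, (∀ k, h ≠ .inl (x, k)) → smooth S' h = smooth S h) →
          ∀ h ∈ T, D.circleOf S' h = D.circleOf S' (.inl (x, i)) := by
  classical
  set h₀ : HalfEdge X J := .inl (x, i) with hh₀
  let ψ : HalfEdge X J → HalfEdge X J := fun h => smooth S (D.glue h)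
  have hinj : Function.Injective ψ := fun a b hab => by
    have := congrArg (fun h => D.glue (smooth S h)) hab
    simpa only [ψ, smooth_smooth, D.glue_glue] using this
  have hos : ∀ h, o (smooth S h) = o h + 1 :=
    apply_smooth_of_rot S (· + 1)
      (fun a => by simp only [add_assoc, CharTwo.add_self_eq_zero, add_zero]) o hr
  -- One step along the strand is an edge followed by a smoothing; each changes the colour, so `ψ`
  -- preserves it. The path ends just after an edge, hence with the other colour.
  have hoψ : ∀ n, o (ψ^[n] h₀) = o h₀ := fun n => by
    induction n with
    | zero => rfl
    | succ n ih =>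
      rw [Function.iterate_succ_apply', hos, hg, ih, add_assoc, CharTwo.add_self_eq_zero, add_zero]
  -- The injective map `ψ` on a finite set returns to `h₀`, and its last smoothing before doing so
  -- takes place at `x`.
  have hex : ∃ n, ∃ k, D.glue (ψ^[n] h₀) = .inl (x, k) := by
    obtain ⟨n, hn, hp⟩ := hinj.mem_periodicPts h₀
    obtain ⟨m, rfl⟩ := Nat.exists_eq_succ_of_ne_zero hn.ne'
    have hp : ψ^[m + 1] h₀ = h₀ := hp
    rw [Function.iterate_succ_apply'] at hp
    obtain ⟨k, hk⟩ := exists_smooth_eq (J := J) S x i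
    refine ⟨m, k, ?_⟩
    rw [← hk, ← hh₀]
    nth_rw 2 [← hp]
    rw [smooth_smooth]
  obtain ⟨j, hj⟩ := Nat.find_spec hex
  have hmin : ∀ m < Nat.find hex, ∀ k, D.glue (ψ^[m] h₀) ≠ .inl (x, k) := fun m hm k hk =>
    Nat.find_min hex hm ⟨k, hk⟩
  set n := Nat.find hex
  refine ⟨j, by rw [← hj, hg, hoψ],
    {h | ∃ m ≤ n, h = ψ^[m] h₀ ∨ h = D.glue (ψ^[m] h₀)}, ?_, ?_, ?_, ?_⟩
  · refine fun k => ⟨?_, ?_⟩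
    · rintro ⟨m, hm, hk | hk⟩
      · rcases m with _ | m
        · left
          simpa [h₀] using hk
        · exfalso
          rw [Function.iterate_succ_apply'] at hk
          obtain ⟨l, hl⟩ := exists_smooth_eq (J := J) S x k
          refine hmin m hm l ?_
          rw [← hl, hk, smooth_smooth]
      · right
        rcases hm.lt_or_eq with hm | rfl
        · exact absurd hk.symm (hmin m hm k)
        · simpa [hj] using hk
    · rintro (rfl | rfl)
      · exact ⟨0, Nat.zero_le _, Or.inl rfl⟩
      · exact ⟨n, le_rfl, Or.inr hj.symm⟩
  · rintro _ ⟨m, hm, rfl | rfl⟩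
    · exact ⟨m, hm, Or.inr rfl⟩
    · exact ⟨m, hm, Or.inl (D.glue_glue _)⟩
  · rintro _ ⟨m, hm, rfl | rfl⟩ hx
    · rcases m with _ | m
      · exact absurd rfl (hx i)
      · exact ⟨m, by omega, Or.inr (by rw [Function.iterate_succ_apply', smooth_smooth])⟩
    · rcases hm.lt_or_eq with hm | rfl
      · exact ⟨m + 1, hm, Or.inl (by rw [Function.iterate_succ_apply'])⟩
      · exact absurd hj (hx j)
  · intro S' hS'
    have key : ∀ m ≤ n, D.circleOf S' (ψ^[m] h₀) = D.circleOf S' h₀ := fun m hm => by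
      induction m with
      | zero => rfl
      | succ m ih =>
        rw [Function.iterate_succ_apply', show ψ _ = _ from (hS' _ (hmin m hm)).symm, circleOf_smooth, circleOf_glue,
          ih (by omega)]
    rintro _ ⟨m, hm, rfl | rfl⟩
    · exact key m hm
    · rw [circleOf_glue, key m hm]

theorem circleOf_crossing (S : Finset X) (x : X) (i : Fin 4) :
    D.circleOf S (.inl (x, i)) = D.strandA S x ∨ D.circleOf S (.inl (x, i)) = D.strandB S x := by
  have h0 := D.circleOf_smooth S (.inl (x, 0))
  have h2 := D.circleOf_smooth S (.inl (x, 2))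
  by_cases hx : x ∈ S
  all_goals
    simp only [smooth, hx, if_true, if_false] at h0 h2
    fin_cases i
    all_goals first
      | exact Or.inl rfl
      | exact Or.inr rfl
      | exact Or.inl h0
      | exact Or.inr h2

/-- Changing the resolution at one crossing either merges two circles or divides one. -/
theorem strands_merge_or_divide {S S' : Finset X} {x : X} (hd : DifferAt S S' x) :
    (D.strandA S x ≠ D.strandB S x ∧ D.strandA S' x = D.strandB S' x) ∨
    (D.strandA S x = D.strandB S x ∧ D.strandA S' x ≠ D.strandB S' x) := by
  wlog hx : x ∉ S generalizing S S' with H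
  · have := H hd.symm (by have := hd.1; tauto)
    tauto
  have hx' : x ∈ S' := by have := hd.1; tauto
  obtain ⟨o, hg, hr⟩ := D.exists_coloring
  obtain ⟨j, hj, T, hT, hTg, hTs, hTc⟩ := D.exists_path S x 0 o hg hr
  have c0 := D.circleOf_smooth S (.inl (x, 0))
  have c2 := D.circleOf_smooth S (.inl (x, 2))
  have c0' := D.circleOf_smooth S' (.inl (x, 0))
  have c2' := D.circleOf_smooth S' (.inl (x, 2))
  simp only [smooth, hx, hx', if_true, if_false] at c0 c2 c0' c2'
  -- If the smoothing at `x` joins the two ends of the path, then `T` is closed under following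
  -- strands and cuts off half-edge `0` from half-edge `2`.
  have hsep : ∀ R : Finset X, (∀ h ∈ T, smooth R h ∈ T) → (2 : Fin 4) ≠ j →
      D.strandA R x ≠ D.strandB R x := by
    intro R hR h2 he
    have hinv : ∀ {σ : HalfEdge X J → HalfEdge X J}, (∀ h, σ (σ h) = h) → (∀ h ∈ T, σ h ∈ T) →
        ∀ h, (σ h ∈ T) = (h ∈ T) := fun hσ hσT h =>
      propext ⟨fun hh => by simpa only [hσ] using hσT _ hh, hσT h⟩
    have := (D.eq_of_circleOf_eq (· ∈ T) (hinv D.glue_glue hTg) (hinv (smooth_smooth R) hR) he).mp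
      ((hT 0).2 (Or.inl rfl))
    rcases (hT 2).1 this with h | h
    · exact absurd h (by decide)
    · exact h2 h
  have o1 := hr (.inl (x, 0))
  have o2 := hr (.inl (x, 1))
  have hne : ∀ a : ZMod 2, a ≠ a + 1 := by decide
  have hne' : ∀ a : ZMod 2, a + 1 + 1 ≠ a + 1 := by decide
  simp only [rot, Fin.isValue, zero_add, Fin.reduceAdd] at o1 o2
  have hjT := (hT j).2 (Or.inr rfl)
  have hTc' := hTc S' (fun h hh => hd.smooth_eq hh) _ hjT
  have hTc := hTc S (fun _ _ => rfl) _ hjT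
  -- The path from half-edge `0` cannot end at `0` or `2`, by colour. If it ends at `1`, the
  -- `0`-resolution closes it up and the `1`-resolution joins it to half-edge `2`; if it ends at
  -- `3`, the roles are exchanged.
  fin_cases j
  · exact absurd hj (hne _)
  · left
    refine ⟨hsep S (fun h hh => ?_) (by decide), ?_⟩
    · by_cases hhx : ∀ k, h ≠ .inl (x, k)
      · exact hTs h hh hhx
      · push Not at hhx
        obtain ⟨k, rfl⟩ := hhx
        rcases (hT k).1 hh with rfl | rfl
        · simpa [smooth, hx] using hjT
        · simpa [smooth, hx] using (hT 0).2 (Or.inl rfl)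
    · exact hTc'.symm.trans c2'
  · refine absurd hj ?_
    change o (.inl (x, 2)) ≠ _
    rw [o2, o1]
    exact hne' _
  · right
    refine ⟨hTc.symm.trans c2, hsep S' (fun h hh => ?_) (by decide)⟩
    by_cases hhx : ∀ k, h ≠ .inl (x, k)
    · rw [hd.smooth_eq hhx]
      exact hTs h hh hhx
    · push Not at hhx
      obtain ⟨k, rfl⟩ := hhx
      rcases (hT k).1 hh with rfl | rfl
      · simpa [smooth, hx'] using hjT
      · simpa [smooth, hx'] using (hT 0).2 (Or.inl rfl)

/-- The circles of `S'` arise from those of `S` by merging the two circles at the crossing `x`. -/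
structure Merges (S S' : Finset X) (x : X) : Prop where
  differAt : DifferAt S S' x
  ne : D.strandA S x ≠ D.strandB S x
  eq : D.strandA S' x = D.strandB S' x

theorem merges_or_merges {S S' : Finset X} {x : X} (hd : DifferAt S S' x) :
    D.Merges S S' x ∨ D.Merges S' S x :=
  (D.strands_merge_or_divide hd).imp (fun h => ⟨hd, h.1, h.2⟩) fun h => ⟨hd.symm, h.2, h.1⟩

/-- The circle passes through the crossing `x`. -/
def Meets (S : Finset X) (x : X) (C : D.Circle S) : Prop :=
  C = D.strandA S x ∨ C = D.strandB S x

namespace Merges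

variable {D} {S S' : Finset X} {x : X} (hm : D.Merges S S' x)
include hm

theorem circleOf_eq {h k : HalfEdge X J} (hk : D.circleOf S h = D.circleOf S k) :
    D.circleOf S' h = D.circleOf S' k := by
  refine D.eq_of_circleOf_eq (D.circleOf S') (D.circleOf_glue S') (fun h => ?_) hk
  by_cases hhx : ∀ k, h ≠ .inl (x, k)
  · rw [← hm.differAt.smooth_eq hhx, circleOf_smooth]
  · push Not at hhx
    obtain ⟨k, rfl⟩ := hhx
    obtain ⟨l, hl⟩ := exists_smooth_eq (J := J) S x k
    have := hm.eq
    rw [hl]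
    rcases D.circleOf_crossing S' x k with h1 | h1 <;>
      rcases D.circleOf_crossing S' x l with h2 | h2 <;> rw [h1, h2] <;> simp [this]

/-- Identifying the two circles of `S` at `x` yields a function `φ` constant along the strands of
`S'`; hence merging identifies nothing else. -/
theorem circleOf_eq_or {h k : HalfEdge X J} (hk : D.circleOf S' h = D.circleOf S' k) :
    D.circleOf S h = D.circleOf S k ∨
      D.Meets S x (D.circleOf S h) ∧ D.Meets S x (D.circleOf S k) := by
  classical
  let φ : HalfEdge X J → D.Circle S := fun h =>
    if D.Meets S x (D.circleOf S h) then D.strandA S x else D.circleOf S h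
  have hφ : φ h = φ k := by
    refine D.eq_of_circleOf_eq φ (fun h => ?_) (fun h => ?_) hk
    · simp only [φ, circleOf_glue]
    · by_cases hhx : ∀ k, h ≠ .inl (x, k)
      · simp only [φ, hm.differAt.smooth_eq hhx, circleOf_smooth]
      · push Not at hhx
        obtain ⟨k, rfl⟩ := hhx
        obtain ⟨l, hl⟩ := exists_smooth_eq (J := J) S' x k
        have h1 : D.Meets S x _ := D.circleOf_crossing S x k
        have h2 : D.Meets S x _ := D.circleOf_crossing S x l
        rw [hl]
        simp only [φ, if_pos h1, if_pos h2]
  simp only [φ] at hφ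
  split_ifs at hφ with h1 h2 h2
  · exact Or.inr ⟨h1, h2⟩
  · exact absurd (Or.inl hφ.symm) h2
  · exact absurd (Or.inl hφ) h1
  · exact Or.inl hφ

theorem circleOf_eq_strandA_iff (h : HalfEdge X J) :
    D.circleOf S' h = D.strandA S' x ↔ D.Meets S x (D.circleOf S h) := by
  constructor
  · intro hh
    rcases hm.circleOf_eq_or hh with h1 | h1
    · exact Or.inl h1
    · exact h1.1
  · rintro (hh | hh)
    · exact hm.circleOf_eq hh
    · exact (hm.circleOf_eq hh).trans hm.eq.symm

theorem meets_iff (h : HalfEdge X J) :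
    D.Meets S' x (D.circleOf S' h) ↔ D.Meets S x (D.circleOf S h) := by
  rw [Meets, ← hm.eq, or_self, hm.circleOf_eq_strandA_iff]

theorem circleOf_eq_iff {h : HalfEdge X J} (hh : ¬ D.Meets S x (D.circleOf S h))
    (k : HalfEdge X J) :
    D.circleOf S' k = D.circleOf S' h ↔ D.circleOf S k = D.circleOf S h :=
  ⟨fun e => (hm.circleOf_eq_or e).resolve_right fun h => hh h.2, hm.circleOf_eq⟩

/-- Omitting the circle `strandB` makes the projection to the circles of `S'` bijective. The count
fixes the quantum degree and excludes inconsistent squares of merges and divisions. -/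
theorem card_circle : Nat.card (D.Circle S) = Nat.card (D.Circle S') + 1 := by
  classical
  have := Fintype.ofFinite (D.Circle S)
  have := Fintype.ofFinite (D.Circle S')
  let π : {C : D.Circle S // C ≠ D.strandB S x} → D.Circle S' := fun C =>
    Quot.lift (D.circleOf S') (fun a b hab => hm.circleOf_eq (Quot.sound hab)) C.1
  have hπ : Function.Bijective π := by
    refine ⟨?_, fun C => ?_⟩
    · rintro ⟨C₁, h₁⟩ ⟨C₂, h₂⟩ h
      obtain ⟨k₁, rfl⟩ := D.exists_circleOf_eq S C₁
      obtain ⟨k₂, rfl⟩ := D.exists_circleOf_eq S C₂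
      refine Subtype.ext ?_
      rcases hm.circleOf_eq_or (h : D.circleOf S' k₁ = D.circleOf S' k₂) with h | h
      · exact h
      · exact (h.1.resolve_right h₁).trans (h.2.resolve_right h₂).symm
    · obtain ⟨k, rfl⟩ := D.exists_circleOf_eq S' C
      by_cases hk : D.circleOf S k = D.strandB S x
      · exact ⟨⟨D.strandA S x, hm.ne⟩, hm.eq.trans (hm.circleOf_eq hk).symm⟩
      · exact ⟨⟨D.circleOf S k, hk⟩, rfl⟩
  rw [← Nat.card_eq_of_bijective π hπ, Nat.card_eq_fintype_card, Nat.card_eq_fintype_card,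
    Fintype.card_subtype_compl, Fintype.card_subtype_eq]
  have : 0 < Fintype.card (D.Circle S) := Fintype.card_pos_iff.2 ⟨D.strandA S x⟩
  omega

theorem circleIndicator_add (h : HalfEdge X J) :
    D.circleIndicator S' (D.strandA S' x) h
      = D.circleIndicator S (D.strandA S x) h + D.circleIndicator S (D.strandB S x) h := by
  have := hm.circleOf_eq_strandA_iff h
  unfold circleIndicator
  by_cases h1 : D.circleOf S h = D.strandA S x
  · rw [if_pos (this.2 (Or.inl h1)), if_pos h1, if_neg (h1.trans_ne hm.ne), add_zero]
  · by_cases h2 : D.circleOf S h = D.strandB S x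
    · rw [if_pos (this.2 (Or.inr h2)), if_neg h1, if_pos h2, zero_add]
    · rw [if_neg fun h3 => (this.1 h3).elim h1 h2, if_neg h1, if_neg h2, zero_add]

theorem area_eq_add {C₁ C₂ : D.Unmarked S} {C : D.Unmarked S'} (h₁ : C₁.1 = D.strandA S x)
    (h₂ : C₂.1 = D.strandB S x) (h : C.1 = D.strandA S' x) :
    D.area S' C = D.area S C₁ + D.area S C₂ :=
  D.area_eq_add C C₁ C₂ fun k => by rw [h, h₁, h₂, hm.circleIndicator_add]

end Merges

end Strands

end LinkDiagram
end TotallyTwisted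

namespace TotallyTwisted

theorem koszulFactor_single {R ι : Type*} [CommRing R] [DecidableEq ι] (r : ι → R) (i : ι)
    (s : ι → Sgn) : koszulFactor r i (Finsupp.single s 1)
      = if s i = .plus then Finsupp.single (Function.update s i .minus) (r i) else 0 := by
  rw [koszulFactor, Finsupp.linearCombination_single, one_smul]
  cases s i <;> rfl

namespace LinkDiagram

/-! ### Pure states -/

section States

variable {X J F : Type*} [Fintype X] [Fintype J] [Fintype F] [DecidableEq X]
  (D : LinkDiagram X J F) {S : Finset X}

/-- An unmarked circle. -/
def unmark {C : D.Circle S} (h : C ≠ D.markedCircle S) : D.Unmarked S := ⟨C, h⟩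

theorem unmark_val (C : D.Unmarked S) : D.unmark C.2 = C := rfl

open Classical in
/-- Change the sign on a circle; nothing happens if it is the marked circle. -/
noncomputable def setSign (s : D.PureState S) (C : D.Circle S) (v : Sgn) : D.PureState S :=
  fun E => if E.1 = C then v else s E

/-- The pure state with `v₊` on every unmarked circle. -/
def plusState (S : Finset X) : D.PureState S := fun _ => .plus

theorem label_eq_none_iff (s : D.PureState S) (C : D.Circle S) :
    D.label s C = none ↔ C = D.markedCircle S := by
  unfold label
  split_ifs with h <;> simp [h]

theorem label_of_ne (s : D.PureState S) {C : D.Circle S} (h : C ≠ D.markedCircle S) :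
    D.label s C = some (s (D.unmark h)) := dif_neg h

theorem label_unmarked (s : D.PureState S) (C : D.Unmarked S) : D.label s C.1 = some (s C) :=
  D.label_of_ne s C.2

theorem ne_markedCircle {s : D.PureState S} {C : D.Circle S} {v : Sgn}
    (hC : D.label s C = some v) : C ≠ D.markedCircle S := fun h => by
  rw [(D.label_eq_none_iff s C).2 h] at hC
  cases hC

theorem setSign_of_eq (s : D.PureState S) {C : D.Circle S} (v : Sgn) {E : D.Unmarked S}
    (h : E.1 = C) : D.setSign s C v E = v := if_pos h

theorem setSign_of_ne (s : D.PureState S) {C : D.Circle S} (v : Sgn) {E : D.Unmarked S}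
    (h : E.1 ≠ C) : D.setSign s C v E = s E := if_neg h

theorem pureState_ext {s t : D.PureState S} (h : ∀ C, D.label s C = D.label t C) : s = t :=
  funext fun C => Option.some_injective _ (by rw [← label_unmarked, ← label_unmarked, h])

theorem label_setSign_self {s : D.PureState S} {C : D.Circle S} {u : Sgn}
    (hC : D.label s C = some u) (v : Sgn) : D.label (D.setSign s C v) C = some v := by
  rw [D.label_of_ne _ (D.ne_markedCircle hC), setSign_of_eq]
  rfl

theorem label_setSign_of_ne (s : D.PureState S) {C E : D.Circle S} (hE : E ≠ C) (v : Sgn) :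
    D.label (D.setSign s C v) E = D.label s E := by
  by_cases h : E = D.markedCircle S
  · rw [(D.label_eq_none_iff _ E).2 h, (D.label_eq_none_iff _ E).2 h]
  · rw [D.label_of_ne _ h, D.label_of_ne _ h, setSign_of_ne]
    exact hE

theorem setSign_setSign (s : D.PureState S) (C : D.Circle S) (u v : Sgn) :
    D.setSign (D.setSign s C u) C v = D.setSign s C v := by
  unfold setSign
  ext E
  split_ifs <;> rfl

theorem setSign_of_label {s : D.PureState S} {C : D.Circle S} {v : Sgn}
    (hC : D.label s C = some v) : D.setSign s C v = s := by
  refine D.pureState_ext fun E => ?_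
  by_cases hE : E = C
  · rw [hE, D.label_setSign_self hC, hC]
  · rw [D.label_setSign_of_ne _ hE]

theorem setSign_comm (s : D.PureState S) {C E : D.Circle S} (h : C ≠ E) (u v : Sgn) :
    D.setSign (D.setSign s C u) E v = D.setSign (D.setSign s E v) C u := by
  unfold setSign
  ext G
  split_ifs with h1 h2
  · exact absurd (h2.symm.trans h1) h
  all_goals rfl

theorem eq_plusState_iff (t : D.PureState S) :
    t = D.plusState S ↔ ∀ C, D.label t C ≠ some .minus := by
  constructor
  · rintro rfl C
    unfold label plusState
    split_ifs <;> simp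
  · refine fun h => funext fun C => ?_
    have := h C.1
    rw [label_unmarked] at this
    change t C = .plus
    cases ht : t C
    · rfl
    · rw [ht] at this
      exact absurd rfl this

theorem label_plusState_ne (C : D.Circle S) : D.label (D.plusState S) C ≠ some .minus :=
  (D.eq_plusState_iff _).1 rfl C

/-- Every pure state arises from the one with `v₊` everywhere by changing signs. -/
theorem pureState_induction {P : D.PureState S → Prop} (plus : P (D.plusState S))
    (step : ∀ s h, D.label s (D.circleOf S h) = some .plus → P s →
      P (D.setSign s (D.circleOf S h) .minus)) (s : D.PureState S) : P s := by
  classical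
  -- Induction on the number of minus signs: turn one of them into a plus, and recover `s` by the
  -- step.
  induction hn : (Finset.univ.filter fun C => s C = .minus).card using Nat.strong_induction_on
    generalizing s with
  | _ n ih =>
    by_cases hs : ∃ C, s C = .minus
    · obtain ⟨C, hC⟩ := hs
      have hl : D.label s C.1 = some .minus := by rw [label_unmarked, hC]
      obtain ⟨h, hh⟩ := D.exists_circleOf_eq S C.1
      have hs : s = D.setSign (D.setSign s C.1 .plus) C.1 .minus := by
        rw [setSign_setSign, D.setSign_of_label hl]
      rw [hs, ← hh]
      refine step _ _ ?_ (ih _ ?_ _ rfl)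
      · rw [hh, D.label_setSign_self hl]
      · rw [← hn, hh]
        refine Finset.card_lt_card ⟨fun E hE => ?_, fun hsub => ?_⟩
        · simp only [Finset.mem_filter, Finset.mem_univ, true_and] at hE ⊢
          unfold setSign at hE
          split_ifs at hE
          exact hE
        · have := hsub (Finset.mem_filter.2 ⟨Finset.mem_univ C, hC⟩)
          rw [Finset.mem_filter, setSign_of_eq _ _ _ rfl] at this
          exact absurd this.2 (by decide)
    · push Not at hs
      rwa [(D.eq_plusState_iff s).2 fun C hC => ?_]
      by_cases hm : C = D.markedCircle S
      · rw [(D.label_eq_none_iff s C).2 hm] at hC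
        cases hC
      · exact hs (D.unmark hm) (Option.some_injective _ (by rw [← label_of_ne, hC]))

/-- The `-1` accounts for the marked circle, which has degree zero. -/
theorem qDeg_plusState : D.qDeg (D.plusState S) = (Nat.card (D.Circle S) : ℤ) - 1 + S.card := by
  classical
  have := Fintype.ofFinite (D.Circle S)
  have h1 : Fintype.card (D.Unmarked S) = Fintype.card (D.Circle S) - 1 := by
    rw [← Nat.card_eq_fintype_card]
    change Nat.card {C : D.Circle S // C ≠ D.markedCircle S} = _
    rw [Nat.card_eq_fintype_card, Fintype.card_subtype_compl, Fintype.card_subtype_eq]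
  have h2 : 0 < Fintype.card (D.Circle S) := Fintype.card_pos_iff.2 ⟨D.markedCircle S⟩
  simp only [qDeg, plusState, Sgn.deg, Finset.sum_const, Finset.card_univ, h1,
    Nat.card_eq_fintype_card]
  rw [nsmul_one, Nat.cast_sub h2, Nat.cast_one]

theorem qDeg_setSign {s : D.PureState S} {C : D.Circle S} (hC : D.label s C = some .plus) :
    D.qDeg (D.setSign s C .minus) = D.qDeg s - 2 := by
  have hs : s (D.unmark (D.ne_markedCircle hC)) = .plus :=
    Option.some_injective _ (by rw [← label_of_ne, hC])
  set E₀ := D.unmark (D.ne_markedCircle hC)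
  have : ∀ E ∈ Finset.univ.erase E₀, (D.setSign s C .minus E).deg = (s E).deg := fun E hE => by
    rw [setSign_of_ne]
    exact fun h => Finset.ne_of_mem_erase hE (Subtype.ext h)
  unfold qDeg
  rw [← Finset.add_sum_erase _ _ (Finset.mem_univ E₀),
    ← Finset.add_sum_erase _ (fun E => (s E).deg) (Finset.mem_univ E₀),
    Finset.sum_congr rfl this, hs, setSign_of_eq]
  · simp only [Sgn.deg]
    ring
  · rfl

end States

/-! ### The operators `v₊ ↦ v₋` on circles -/

section CircleOp

variable {X J F : Type*} [Fintype X] [Fintype J] [Fintype F] [DecidableEq X]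
  (D : LinkDiagram X J F) (S : Finset X)

open Classical in
/-- The map `v₊ ↦ v₋`, `v₋ ↦ 0`, `v₀ ↦ 0` on the factor of a circle. -/
noncomputable def circleOp (C : D.Circle S) : D.V S →ₗ[FaceRing F] D.V S :=
  if h : C = D.markedCircle S then 0 else koszulFactor (fun _ => 1) (D.unmark h)

theorem circleOp_marked : D.circleOp S (D.markedCircle S) = 0 := dif_pos rfl

open Classical in
theorem circleOp_single (C : D.Circle S) (s : D.PureState S) :
    D.circleOp S C (Finsupp.single s 1)
      = if D.label s C = some .plus then Finsupp.single (D.setSign s C .minus) 1 else 0 := by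
  by_cases h : C = D.markedCircle S
  · subst h
    rw [circleOp_marked, (D.label_eq_none_iff s _).2 rfl, if_neg (by simp)]
    rfl
  · rw [circleOp, dif_neg h, koszulFactor_single, D.label_of_ne s h]
    have : Function.update s (D.unmark h) .minus = D.setSign s C .minus := by
      ext E
      by_cases hE : E = D.unmark h
      · rw [hE, Function.update_self, setSign_of_eq]
        rfl
      · rw [Function.update_of_ne hE, setSign_of_ne]
        exact fun e => hE (Subtype.ext e)
    rw [this]
    exact if_congr (Option.some_injective _).eq_iff.symm rfl rfl

theorem circleOp_single_of_plus {C : D.Circle S} {s : D.PureState S}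
    (h : D.label s C = some .plus) :
    D.circleOp S C (Finsupp.single s 1) = Finsupp.single (D.setSign s C .minus) 1 := by
  rw [circleOp_single, if_pos h]

variable {S} in
theorem V_hom_ext {M : Type*} [AddCommMonoid M] [Module (FaceRing F) M]
    {f g : D.V S →ₗ[FaceRing F] M}
    (h : ∀ s, f (Finsupp.single s 1) = g (Finsupp.single s 1)) : f = g :=
  Finsupp.lhom_ext' fun s => LinearMap.ext_ring (h s)

open Classical in
-- The transposed description of the operator by coefficients: the only preimage of a state with
-- `v₋` on `C` has `v₊` there.
theorem circleOp_apply (C : D.Circle S) (v : D.V S) (t : D.PureState S) :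
    D.circleOp S C v t = if D.label t C = some .minus then v (D.setSign t C .plus) else 0 := by
  let ev : D.PureState S → D.V S →ₗ[FaceRing F] FaceRing F := Finsupp.lapply
  have : ev t ∘ₗ D.circleOp S C
      = if D.label t C = some .minus then ev (D.setSign t C .plus) else 0 := by
    refine D.V_hom_ext fun s => ?_
    rw [LinearMap.comp_apply, circleOp_single]
    by_cases h1 : D.label s C = some .plus
    · rw [if_pos h1]
      by_cases h2 : D.label t C = some .minus
      · rw [if_pos h2]
        simp only [ev, Finsupp.lapply_apply, Finsupp.single_apply]
        refine if_congr ⟨?_, ?_⟩ rfl rfl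
        · rintro rfl
          rw [setSign_setSign, D.setSign_of_label h1]
        · rintro rfl
          rw [setSign_setSign, D.setSign_of_label h2]
      · rw [if_neg h2]
        refine Finsupp.single_eq_of_ne ?_
        rintro rfl
        exact h2 (D.label_setSign_self h1 _)
    · rw [if_neg h1, map_zero]
      split_ifs with h2
      · refine (Finsupp.single_eq_of_ne ?_).symm
        rintro rfl
        exact h1 (D.label_setSign_self h2 _)
      · rfl
  have := LinearMap.congr_fun this v
  rw [LinearMap.comp_apply] at this
  refine this.trans ?_
  split_ifs <;> rfl

theorem circleOp_circleOp_self (C : D.Circle S) (v : D.V S) :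
    D.circleOp S C (D.circleOp S C v) = 0 := by
  ext1 t
  rw [circleOp_apply]
  split_ifs with h
  · rw [circleOp_apply, D.label_setSign_self h, if_neg (by simp)]
    rfl
  · rfl

theorem circleOp_comm (C E : D.Circle S) (v : D.V S) :
    D.circleOp S C (D.circleOp S E v) = D.circleOp S E (D.circleOp S C v) := by
  by_cases hCE : C = E
  · rw [hCE]
  · ext1 t
    simp only [circleOp_apply, D.label_setSign_of_ne t hCE, D.label_setSign_of_ne t (Ne.symm hCE),
      D.setSign_comm t hCE]
    split_ifs <;> rfl

theorem dV_eq_sum : D.dV S = ∑ C, D.area S C • D.circleOp S C.1 := by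
  refine Finset.sum_congr rfl fun C _ => D.V_hom_ext fun s => ?_
  rw [LinearMap.smul_apply, circleOp, dif_neg C.2, koszulFactor_single, koszulFactor_single,
    unmark_val, smul_ite, smul_zero, Finsupp.smul_single, smul_eq_mul, mul_one]

end CircleOp

/-! ### The Khovanov edge maps -/

section EdgeMap

variable {X J F : Type*} [Fintype X] [Fintype J] [Fintype F] [DecidableEq X]
  (D : LinkDiagram X J F) {S : Finset X} {x : X}

namespace DifferAt

variable {D} {S' : Finset X} (hd : DifferAt S S' x)
include hd

theorem meets_iff (h : HalfEdge X J) :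
    D.Meets S' x (D.circleOf S' h) ↔ D.Meets S x (D.circleOf S h) :=
  (D.merges_or_merges hd).elim (fun hm => hm.meets_iff h) fun hm => (hm.meets_iff h).symm

theorem circleOf_eq_iff {h : HalfEdge X J} (hh : ¬ D.Meets S x (D.circleOf S h))
    (k : HalfEdge X J) :
    D.circleOf S' k = D.circleOf S' h ↔ D.circleOf S k = D.circleOf S h :=
  (D.merges_or_merges hd).elim (fun hm => hm.circleOf_eq_iff hh k) fun hm =>
    (hm.circleOf_eq_iff (by rwa [hm.meets_iff] at hh) k).symm

end DifferAt

/-- The pure states agree on the circles that do not pass through `x`. -/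
def AgreeOff (S : Finset X) (x : X) (s : D.PureState S) (t : D.PureState (insert x S)) : Prop :=
  ∀ h, ¬ D.Meets S x (D.circleOf S h) →
    D.label t (D.circleOf (insert x S) h) = D.label s (D.circleOf S h)

theorem occurs_iff_of_merges (hm : D.Merges S (insert x S) x) (s : D.PureState S)
    (t : D.PureState (insert x S)) :
    D.Occurs S x s t ↔ D.AgreeOff S x s t ∧ D.label t (D.strandA (insert x S) x) ∈
      mu (D.label s (D.strandA S x)) (D.label s (D.strandB S x)) := by
  have := hm.ne
  simp only [Occurs, AgreeOff, Meets, not_or, and_imp, ne_eq, this, not_false_eq_true,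
    forall_true_left, false_imp_iff, and_true]

theorem occurs_iff_of_divides (hm : D.Merges (insert x S) S x) (s : D.PureState S)
    (t : D.PureState (insert x S)) :
    D.Occurs S x s t ↔ D.AgreeOff S x s t ∧
      (D.label t (D.strandA (insert x S) x), D.label t (D.strandB (insert x S) x)) ∈
        delta (D.label s (D.strandA S x)) := by
  have := hm.eq
  simp only [Occurs, AgreeOff, Meets, not_or, and_imp, ne_eq, this, not_true_eq_false,
    forall_true_left, false_imp_iff, true_and]

theorem agreeOff_setSign_iff_of_meets (hd : DifferAt S (insert x S) x) {h : HalfEdge X J}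
    (hh : D.Meets S x (D.circleOf S h)) (u v : Sgn) (s : D.PureState S)
    (t : D.PureState (insert x S)) :
    D.AgreeOff S x (D.setSign s (D.circleOf S h) u) t ↔
      D.AgreeOff S x s (D.setSign t (D.circleOf (insert x S) h) v) := by
  refine forall₂_congr fun k hk => ?_
  rw [label_setSign_of_ne, label_setSign_of_ne]
  · intro e
    rw [← hd.meets_iff, ← e, hd.meets_iff] at hh
    exact hk hh
  · intro e
    exact hk (e ▸ hh)

theorem agreeOff_setSign_iff_of_not_meets (hd : DifferAt S (insert x S) x) {h : HalfEdge X J}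
    (hh : ¬ D.Meets S x (D.circleOf S h)) (s : D.PureState S) (t : D.PureState (insert x S)) :
    D.label s (D.circleOf S h) = some .plus ∧
        D.AgreeOff S x (D.setSign s (D.circleOf S h) .minus) t ↔
      D.label t (D.circleOf (insert x S) h) = some .minus ∧
        D.AgreeOff S x s (D.setSign t (D.circleOf (insert x S) h) .plus) := by
  constructor
  · rintro ⟨hs, ha⟩
    have ht := ha h hh
    rw [D.label_setSign_self hs] at ht
    refine ⟨ht, fun k hk => ?_⟩
    by_cases hkh : D.circleOf S k = D.circleOf S h
    · rw [(hd.circleOf_eq_iff hh k).2 hkh, D.label_setSign_self ht, hkh, hs]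
    · rw [D.label_setSign_of_ne _ (mt (hd.circleOf_eq_iff hh k).1 hkh), ha k hk,
        D.label_setSign_of_ne _ hkh]
  · rintro ⟨ht, ha⟩
    have hs := ha h hh
    rw [D.label_setSign_self ht] at hs
    refine ⟨hs.symm, fun k hk => ?_⟩
    by_cases hkh : D.circleOf S k = D.circleOf S h
    · rw [(hd.circleOf_eq_iff hh k).2 hkh, hkh, D.label_setSign_self hs.symm, ht]
    · rw [D.label_setSign_of_ne _ hkh, ← ha k hk,
        D.label_setSign_of_ne _ (mt (hd.circleOf_eq_iff hh k).1 hkh)]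

/-- Written in matrix entries, `μ` commutes with `v₊ ↦ v₋` applied to one input and to the output.
The lemmas on `delta` say the same for the input and either output. -/
theorem mu_shift_left : ∀ a b c : Label, a = some .plus ∧ c ∈ mu (some .minus) b ↔
    c = some .minus ∧ some .plus ∈ mu a b := by decide

theorem mu_comm : ∀ a b : Label, mu a b = mu b a := by decide

theorem delta_shift_left : ∀ a b c : Label, a = some .plus ∧ (b, c) ∈ delta (some .minus) ↔
    b = some .minus ∧ (some .plus, c) ∈ delta a := by decide

theorem delta_shift_right : ∀ a b c : Label, a = some .plus ∧ (b, c) ∈ delta (some .minus) ↔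
    c = some .minus ∧ (b, some .plus) ∈ delta a := by decide

/-- This is the identity `edgeMap_circleOp` in matrix entries. At a circle through `x` it is a
finite check on `mu` and `delta`; at any other circle the operator acts on a factor where the edge
map is the identity. -/
theorem occurs_setSign_iff (hd : DifferAt S (insert x S) x) (h : HalfEdge X J) (s : D.PureState S)
    (t : D.PureState (insert x S)) :
    D.label s (D.circleOf S h) = some .plus ∧
        D.Occurs S x (D.setSign s (D.circleOf S h) .minus) t ↔
      D.label t (D.circleOf (insert x S) h) = some .minus ∧
        D.Occurs S x s (D.setSign t (D.circleOf (insert x S) h) .plus) := by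
  by_cases hh : D.Meets S x (D.circleOf S h)
  · have hoff := D.agreeOff_setSign_iff_of_meets hd hh .minus .plus s t
    rcases D.merges_or_merges hd with hm | hm
    · have hh' := (hm.circleOf_eq_strandA_iff h).2 hh
      rw [D.occurs_iff_of_merges hm, D.occurs_iff_of_merges hm, hoff, and_left_comm,
        and_left_comm (a := D.label t _ = _)]
      refine and_congr_right fun _ => ?_
      rw [hh']
      have hr : ∀ b : Finset Label, D.label t (D.strandA (insert x S) x) = some .minus ∧
          D.label (D.setSign t (D.strandA (insert x S) x) .plus) (D.strandA (insert x S) x) ∈ b ↔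
          D.label t (D.strandA (insert x S) x) = some .minus ∧ some .plus ∈ b := fun b =>
        and_congr_right fun e => by rw [D.label_setSign_self e]
      rw [hr]
      rcases hh with hh | hh <;> rw [hh]
      · rw [← mu_shift_left]
        refine and_congr_right fun e => ?_
        rw [D.label_setSign_self e, D.label_setSign_of_ne _ hm.ne.symm]
      · rw [mu_comm (D.label s _), ← mu_shift_left]
        refine and_congr_right fun e => ?_
        rw [mu_comm, D.label_setSign_self e, D.label_setSign_of_ne _ hm.ne]
    · have hA := (hm.circleOf_eq_strandA_iff h).2 ((hm.meets_iff h).1 hh)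
      rw [D.occurs_iff_of_divides hm, D.occurs_iff_of_divides hm, hoff, and_left_comm,
        and_left_comm (a := D.label t _ = _)]
      refine and_congr_right fun _ => ?_
      rw [hA]
      have hl : ∀ b : Label × Label, D.label s (D.strandA S x) = some .plus ∧
          b ∈ delta (D.label (D.setSign s (D.strandA S x) .minus) (D.strandA S x)) ↔
          D.label s (D.strandA S x) = some .plus ∧ b ∈ delta (some .minus) := fun b =>
        and_congr_right fun e => by rw [D.label_setSign_self e]
      rw [hl]
      rcases (hm.meets_iff h).1 hh with hh | hh <;> rw [hh]
      · rw [delta_shift_left]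
        refine and_congr_right fun e => ?_
        rw [D.label_setSign_self e, D.label_setSign_of_ne _ hm.ne.symm]
      · rw [delta_shift_right]
        refine and_congr_right fun e => ?_
        rw [D.label_setSign_self e, D.label_setSign_of_ne _ hm.ne]
  · have hoff := D.agreeOff_setSign_iff_of_not_meets hd hh s t
    have hA : D.strandA S x ≠ D.circleOf S h := fun e => hh (Or.inl e.symm)
    have hB : D.strandB S x ≠ D.circleOf S h := fun e => hh (Or.inr e.symm)
    rw [← hd.meets_iff] at hh
    have hA' : D.strandA (insert x S) x ≠ D.circleOf (insert x S) h := fun e => hh (Or.inl e.symm)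
    have hB' : D.strandB (insert x S) x ≠ D.circleOf (insert x S) h := fun e => hh (Or.inr e.symm)
    rcases D.merges_or_merges hd with hm | hm
    · rw [D.occurs_iff_of_merges hm, D.occurs_iff_of_merges hm, ← and_assoc, ← and_assoc, hoff,
        D.label_setSign_of_ne _ hA, D.label_setSign_of_ne _ hB, D.label_setSign_of_ne _ hA']
    · rw [D.occurs_iff_of_divides hm, D.occurs_iff_of_divides hm, ← and_assoc, ← and_assoc, hoff,
        D.label_setSign_of_ne _ hA, D.label_setSign_of_ne _ hB', D.label_setSign_of_ne _ hA']

open Classical in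
theorem edgeMap_single_apply (s : D.PureState S) (t : D.PureState (insert x S)) :
    D.edgeMap S x (Finsupp.single s 1) t = if D.Occurs S x s t then 1 else 0 := by
  rw [edgeMap, Finsupp.linearCombination_single, one_smul, Finsupp.finsetSum_apply,
    Finset.sum_eq_single t]
  · split_ifs
    · exact Finsupp.single_eq_same
    · rfl
  · intro b _ hb
    split_ifs
    · exact Finsupp.single_eq_of_ne hb.symm
    · rfl
  · exact fun h => absurd (Finset.mem_univ t) h

/-- Indexing the operators by half-edges rather than circles makes sense in every resolution at
once, and gives a single formula for merging, dividing and distant circles. -/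
theorem edgeMap_circleOp (hx : x ∉ S) (h : HalfEdge X J) (v : D.V S) :
    D.edgeMap S x (D.circleOp S (D.circleOf S h) v)
      = D.circleOp (insert x S) (D.circleOf (insert x S) h) (D.edgeMap S x v) := by
  classical
  refine LinearMap.congr_fun (f := D.edgeMap S x ∘ₗ D.circleOp S (D.circleOf S h))
    (g := D.circleOp (insert x S) (D.circleOf (insert x S) h) ∘ₗ D.edgeMap S x)
    (D.V_hom_ext fun s => ?_) v
  ext1 t
  have key := D.occurs_setSign_iff (differAt_insert hx) h s t
  rw [LinearMap.comp_apply, LinearMap.comp_apply, circleOp_single, circleOp_apply,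
    edgeMap_single_apply]
  trans if D.label s (D.circleOf S h) = some .plus ∧
        D.Occurs S x (D.setSign s (D.circleOf S h) .minus) t then 1 else 0
  · rw [ite_and]
    by_cases h1 : D.label s (D.circleOf S h) = some .plus
    · rw [if_pos h1, if_pos h1, edgeMap_single_apply]
    · rw [if_neg h1, if_neg h1, map_zero]
      rfl
  · rw [← ite_and]
    exact if_congr key rfl rfl

theorem markedCircle_eq_iff {S' : Finset X} (hd : DifferAt S S' x) {h : HalfEdge X J}
    (hh : ¬ D.Meets S x (D.circleOf S h)) :
    D.circleOf S' h = D.markedCircle S' ↔ D.circleOf S h = D.markedCircle S := by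
  rw [eq_comm, markedCircle, hd.circleOf_eq_iff hh, eq_comm, markedCircle]

theorem Merges.markedCircle_eq_iff {D : LinkDiagram X J F} {S' : Finset X}
    (hm : D.Merges S S' x) : D.strandA S' x = D.markedCircle S' ↔
      D.strandA S x = D.markedCircle S ∨ D.strandB S x = D.markedCircle S := by
  rw [eq_comm, markedCircle, hm.circleOf_eq_strandA_iff, Meets, eq_comm,
    eq_comm (b := D.strandB S x), markedCircle]

theorem label_eq_of_ne_minus : ∀ a b : Label, a ≠ some .minus → b ≠ some .minus →
    (a = none ↔ b = none) → a = b := by decide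

/-- Labels that are not `v₋` are `v₊`, or `v₀` on the marked circle. The conditions on `none` state
that the marked circle stays marked and that two different circles are not both marked. -/
theorem mem_mu_iff : ∀ a b c : Label, a ≠ some .minus → b ≠ some .minus →
    ¬ (a = none ∧ b = none) → (c = none ↔ a = none ∨ b = none) →
    (c ∈ mu a b ↔ c ≠ some .minus) := by decide

theorem mem_delta_iff : ∀ a b c : Label, a ≠ some .minus → ¬ (b = none ∧ c = none) →
    (a = none ↔ b = none ∨ c = none) →
    ((b, c) ∈ delta a ↔ (b = some .minus ∧ c ≠ some .minus) ∨
      (b ≠ some .minus ∧ c = some .minus)) := by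
  rintro (_ | _ | _) (_ | _ | _) (_ | _ | _) <;> decide

theorem agreeOff_plusState_iff (hd : DifferAt S (insert x S) x) (t : D.PureState (insert x S)) :
    D.AgreeOff S x (D.plusState S) t ↔
      ∀ C, ¬ D.Meets (insert x S) x C → D.label t C ≠ some .minus := by
  constructor
  · intro ha C hC
    obtain ⟨h, rfl⟩ := D.exists_circleOf_eq _ C
    rw [hd.meets_iff] at hC
    rw [ha h hC]
    exact D.label_plusState_ne _
  · intro ha h hh
    refine label_eq_of_ne_minus _ _ (ha _ (by rwa [hd.meets_iff])) (D.label_plusState_ne _) ?_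
    rw [label_eq_none_iff, label_eq_none_iff, D.markedCircle_eq_iff hd hh]

theorem edgeMap_plusState_of_merges (hm : D.Merges S (insert x S) x) :
    D.edgeMap S x (Finsupp.single (D.plusState S) 1)
      = Finsupp.single (D.plusState (insert x S)) 1 := by
  classical
  ext1 t
  rw [edgeMap_single_apply, Finsupp.single_apply]
  refine if_congr ?_ rfl rfl
  rw [eq_comm, eq_plusState_iff, D.occurs_iff_of_merges hm, D.agreeOff_plusState_iff hm.differAt,
    mem_mu_iff _ _ _ (D.label_plusState_ne _) (D.label_plusState_ne _)]
  · constructor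
    · rintro ⟨h1, h2⟩ C
      by_cases hC : D.Meets (insert x S) x C
      · rw [Meets, ← hm.eq, or_self] at hC
        rwa [hC]
      · exact h1 C hC
    · exact fun h => ⟨fun C _ => h C, h _⟩
  · rw [label_eq_none_iff, label_eq_none_iff]
    exact fun h => hm.ne (h.1.trans h.2.symm)
  · rw [label_eq_none_iff, label_eq_none_iff, label_eq_none_iff, hm.markedCircle_eq_iff]

theorem eq_setSign_plus_iff {C : D.Circle S} {t : D.PureState S}
    (hC : D.label t C = some .minus) :
    D.setSign t C .plus = D.plusState S ↔ ∀ E, E ≠ C → D.label t E ≠ some .minus := by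
  rw [eq_plusState_iff]
  refine forall_congr' fun E => ?_
  by_cases hE : E = C
  · simp [hE, D.label_setSign_self hC]
  · simp [hE, D.label_setSign_of_ne]

/-- `Δ v₊ = v₊ ⊗ v₋ + v₋ ⊗ v₊`: exactly one of the two new circles receives `v₋`. If one of them is
marked, its operator is zero and the formula reduces to `Δ v₀ = v₀ ⊗ v₋`. -/
theorem edgeMap_plusState_of_divides (hm : D.Merges (insert x S) S x) :
    D.edgeMap S x (Finsupp.single (D.plusState S) 1)
      = D.circleOp (insert x S) (D.strandA (insert x S) x)
          (Finsupp.single (D.plusState (insert x S)) 1)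
        + D.circleOp (insert x S) (D.strandB (insert x S) x)
          (Finsupp.single (D.plusState (insert x S)) 1) := by
  classical
  ext1 t
  have hcoeff : ∀ C, D.circleOp (insert x S) C (Finsupp.single (D.plusState (insert x S)) 1) t
      = if D.label t C = some .minus ∧ ∀ E, E ≠ C → D.label t E ≠ some .minus then 1 else 0 :=
    fun C => by
      rw [circleOp_apply, Finsupp.single_apply, ← ite_and]
      exact if_congr (and_congr_right fun h => eq_comm.trans (D.eq_setSign_plus_iff h)) rfl rfl
  rw [edgeMap_single_apply, Finsupp.add_apply, hcoeff, hcoeff]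
  have key : D.Occurs S x (D.plusState S) t ↔
      (D.label t (D.strandA (insert x S) x) = some .minus ∧
        ∀ E, E ≠ D.strandA (insert x S) x → D.label t E ≠ some .minus) ∨
      (D.label t (D.strandB (insert x S) x) = some .minus ∧
        ∀ E, E ≠ D.strandB (insert x S) x → D.label t E ≠ some .minus) := by
    rw [D.occurs_iff_of_divides hm, D.agreeOff_plusState_iff hm.differAt.symm,
      mem_delta_iff _ _ _ (D.label_plusState_ne _)]
    · constructor
      · rintro ⟨h1, ⟨h2, h3⟩ | ⟨h2, h3⟩⟩
        · refine Or.inl ⟨h2, fun E hE => ?_⟩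
          by_cases hEB : E = D.strandB (insert x S) x
          · rwa [hEB]
          · exact h1 E (not_or.2 ⟨hE, hEB⟩)
        · refine Or.inr ⟨h3, fun E hE => ?_⟩
          by_cases hEA : E = D.strandA (insert x S) x
          · rwa [hEA]
          · exact h1 E (not_or.2 ⟨hEA, hE⟩)
      · rintro (⟨h1, h2⟩ | ⟨h1, h2⟩)
        · exact ⟨fun C hC => h2 C fun e => hC (Or.inl e), Or.inl ⟨h1, h2 _ hm.ne.symm⟩⟩
        · exact ⟨fun C hC => h2 C fun e => hC (Or.inr e), Or.inr ⟨h2 _ hm.ne, h1⟩⟩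
    · rw [label_eq_none_iff, label_eq_none_iff]
      exact fun h => hm.ne (h.1.trans h.2.symm)
    · rw [label_eq_none_iff, label_eq_none_iff, label_eq_none_iff, hm.markedCircle_eq_iff]
  by_cases h1 : D.label t (D.strandA (insert x S) x) = some .minus ∧
        ∀ E, E ≠ D.strandA (insert x S) x → D.label t E ≠ some .minus
  -- The two alternatives exclude each other because the two circles are different, so no
  -- coefficient `1 + 1` arises.
  · rw [if_pos (key.2 (Or.inl h1)), if_pos h1, if_neg fun h => h1.2 _ hm.ne.symm h.1, add_zero]
  · rw [if_neg h1, zero_add]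
    exact if_congr (key.trans (or_iff_right h1)) rfl rfl

end EdgeMap

end LinkDiagram
end TotallyTwisted

namespace TotallyTwisted

/-- In characteristic two, a sum of commuting elements of square zero has square zero. -/
theorem sum_mul_sum_eq_zero {A ι : Type*} [Semiring A] (hA : ∀ a : A, a + a = 0) (e : ι → A)
    (hsq : ∀ i, e i * e i = 0) (hcomm : ∀ i j, e i * e j = e j * e i) (s : Finset ι) :
    (∑ i ∈ s, e i) * ∑ i ∈ s, e i = 0 := by
  classical
  induction s using Finset.induction_on with
  | empty => simp
  | insert i s hi ih =>
    have : e i * ∑ j ∈ s, e j = (∑ j ∈ s, e j) * e i := by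
      rw [Finset.mul_sum, Finset.sum_mul]
      exact Finset.sum_congr rfl fun j _ => hcomm i j
    rw [Finset.sum_insert hi, add_mul, mul_add, mul_add, hsq, ih, this, zero_add, add_zero, hA]

namespace LinkDiagram

open scoped DirectSum

theorem add_self_eq_zero_of_faceRing {F M : Type*} [AddCommMonoid M] [Module (FaceRing F) M]
    (a : M) : a + a = 0 := by
  have h : (1 + 1 : FaceRing F) = 0 := CharTwo.add_self_eq_zero 1
  rw [← one_smul (FaceRing F) a, ← add_smul, h, zero_smul]

/-! ### The edge maps are chain maps -/

section ChainMap

variable {X J F : Type*} [Fintype X] [Fintype J] [Fintype F] [DecidableEq X]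
  (D : LinkDiagram X J F)

theorem dV_comp_dV (S : Finset X) : D.dV S ∘ₗ D.dV S = 0 := by
  rw [dV_eq_sum]
  refine sum_mul_sum_eq_zero (A := Module.End (FaceRing F) (D.V S))
    (add_self_eq_zero_of_faceRing (F := F)) _ (fun C => ?_) (fun C E => ?_) _
  · refine LinearMap.ext fun v => ?_
    simp [Module.End.mul_apply, circleOp_circleOp_self]
  · refine LinearMap.ext fun v => ?_
    simp only [Module.End.mul_apply, LinearMap.smul_apply, map_smul, D.circleOp_comm S C.1 E.1,
      smul_comm (D.area S C)]

open Classical in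
/-- The area of a circle, or zero for the marked circle. -/
noncomputable def circleArea (S : Finset X) (C : D.Circle S) : FaceRing F :=
  if h : C = D.markedCircle S then 0 else D.area S (D.unmark h)

noncomputable instance (S : Finset X) : Fintype (D.Circle S) := Fintype.ofFinite _

noncomputable instance (S : Finset X) : DecidableEq (D.Circle S) := Classical.decEq _

/-- Including the marked circle is harmless, since its operator is zero, and makes the sum run over
all circles uniformly. -/
theorem dV_apply (S : Finset X) (v : D.V S) :
    D.dV S v = ∑ C, D.circleArea S C • D.circleOp S C v := by
  rw [← Finset.add_sum_erase _ _ (Finset.mem_univ (D.markedCircle S)), circleOp_marked,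
    LinearMap.zero_apply, smul_zero, zero_add, dV_eq_sum, LinearMap.sum_apply]
  refine Finset.sum_bij (fun C _ => C.1) (fun C _ => Finset.mem_erase.2 ⟨C.2, Finset.mem_univ _⟩)
    (fun C _ E _ h => Subtype.ext h) (fun C hC => ?_) fun C _ => ?_
  · exact ⟨D.unmark (Finset.ne_of_mem_erase hC), Finset.mem_univ _, rfl⟩
  · rw [circleArea, dif_neg C.2, unmark_val, LinearMap.smul_apply]

/-- The areas add up when two circles merge. -/
theorem Merges.circleArea_smul {D : LinkDiagram X J F} {S S' : Finset X} {x : X}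
    (hm : D.Merges S S' x)
    {M : Type*} [AddCommMonoid M] [Module (FaceRing F) M] (m : M)
    (h0 : D.strandA S' x = D.markedCircle S' → m = 0) :
    D.circleArea S' (D.strandA S' x) • m
      = D.circleArea S (D.strandA S x) • m + D.circleArea S (D.strandB S x) • m := by
  by_cases h : D.strandA S' x = D.markedCircle S'
  -- A marked circle has been given area zero, but an unmarked circle merging into it may have
  -- nonzero area; here the equation holds because `m` vanishes.
  · simp [h0 h]
  · obtain ⟨hA, hB⟩ := not_or.1 (mt hm.markedCircle_eq_iff.2 h)
    rw [circleArea, circleArea, circleArea, dif_neg h, dif_neg hA, dif_neg hB, ← add_smul]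
    exact congrArg (· • m) (hm.area_eq_add (C₁ := D.unmark hA) (C₂ := D.unmark hB)
      (C := D.unmark h) rfl rfl rfl)

/-- Off the crossing, merging does not change the circles and their areas. -/
theorem Merges.sum_circleArea_smul {D : LinkDiagram X J F} {S S' : Finset X} {x : X}
    (hm : D.Merges S S' x)
    {M : Type*} [AddCommMonoid M] [Module (FaceRing F) M] (Y : D.Circle S → M)
    (Y' : D.Circle S' → M) (hY : ∀ h, Y (D.circleOf S h) = Y' (D.circleOf S' h))
    (h0 : Y' (D.markedCircle S') = 0) :
    ∑ C, D.circleArea S C • Y C = ∑ C, D.circleArea S' C • Y' C := by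
  have hB : D.strandB S x ∈ Finset.univ.erase (D.strandA S x) :=
    Finset.mem_erase.2 ⟨hm.ne.symm, Finset.mem_univ _⟩
  rw [← Finset.add_sum_erase _ _ (Finset.mem_univ (D.strandA S x)),
    ← Finset.add_sum_erase _ _ hB,
    ← Finset.add_sum_erase _ _ (Finset.mem_univ (D.strandA S' x)),
    hm.circleArea_smul _ fun h => by rw [h, h0], add_assoc]
  have hYA : Y (D.strandA S x) = Y' (D.strandA S' x) := hY _
  have hYB : Y (D.strandB S x) = Y' (D.strandA S' x) := (hY _).trans (by rw [hm.eq]; rfl)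
  rw [hYA, hYB]
  congr 2
  have hmem : ∀ C, C ∈ (Finset.univ.erase (D.strandA S x)).erase (D.strandB S x)
      ↔ ¬ D.Meets S x C := fun C => by
    simp [Meets, and_comm]
  let π : D.Circle S → D.Circle S' :=
    Quot.lift (D.circleOf S') fun a b hab => hm.circleOf_eq (Quot.sound hab)
  refine Finset.sum_bij (fun C _ => π C) (fun C hC => ?_) (fun C hC E hE e => ?_)
    (fun C hC => ?_) fun C hC => ?_
  · obtain ⟨h, rfl⟩ := D.exists_circleOf_eq S C
    rw [hmem, ← hm.circleOf_eq_strandA_iff] at hC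
    exact Finset.mem_erase.2 ⟨hC, Finset.mem_univ _⟩
  · obtain ⟨h, rfl⟩ := D.exists_circleOf_eq S C
    obtain ⟨k, rfl⟩ := D.exists_circleOf_eq S E
    exact (hm.circleOf_eq_iff ((hmem _).1 hE) h).1 e
  · obtain ⟨h, rfl⟩ := D.exists_circleOf_eq S' C
    refine ⟨D.circleOf S h, (hmem _).2 fun hh => ?_, rfl⟩
    exact Finset.ne_of_mem_erase hC ((hm.circleOf_eq_strandA_iff h).2 hh)
  · obtain ⟨h, rfl⟩ := D.exists_circleOf_eq S C
    rw [hmem] at hC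
    rw [hY]
    congr 1
    change _ = D.circleArea S' (D.circleOf S' h)
    have hiff := D.markedCircle_eq_iff hm.differAt hC
    by_cases h1 : D.circleOf S h = D.markedCircle S
    · rw [circleArea, circleArea, dif_pos h1, dif_pos (hiff.2 h1)]
    · rw [circleArea, circleArea, dif_neg h1, dif_neg (mt hiff.1 h1)]
      -- A circle away from `x` has the same edges in both resolutions, so one potential computes
      -- both areas.
      obtain ⟨χ, hχ, hχ0⟩ := D.exists_isPotential S (D.circleOf S h)
      rw [D.area_eq_of_isPotential S (D.unmark h1) χ hχ hχ0,
        D.area_eq_of_isPotential S' (D.unmark (mt hiff.1 h1)) χ (fun k => ?_) hχ0]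
      rw [hχ k]
      exact if_congr (hm.circleOf_eq_iff hC k).symm rfl rfl

/-- Expand both differentials into operators and move them past the edge map. The coefficients match
by additivity of areas, read from left to right for a merge and from right to left for a division.
-/
theorem edgeMap_comp_dV {S : Finset X} {x : X} (hx : x ∉ S) :
    D.edgeMap S x ∘ₗ D.dV S = D.dV (insert x S) ∘ₗ D.edgeMap S x := by
  refine LinearMap.ext fun v => ?_
  have hY := fun h => D.edgeMap_circleOp hx h v
  simp only [LinearMap.comp_apply, dV_apply, map_sum, map_smul]
  rcases D.merges_or_merges (differAt_insert hx) with hm | hm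
  · exact hm.sum_circleArea_smul (fun C => D.edgeMap S x (D.circleOp S C v))
      (fun C => D.circleOp (insert x S) C (D.edgeMap S x v)) hY
      (by rw [circleOp_marked, LinearMap.zero_apply])
  · exact (hm.sum_circleArea_smul (fun C => D.circleOp (insert x S) C (D.edgeMap S x v))
      (fun C => D.edgeMap S x (D.circleOp S C v)) (fun h => (hY h).symm)
      (by rw [circleOp_marked, LinearMap.zero_apply, map_zero])).symm

end ChainMap

/-! ### The total complex and its bigrading -/

section Total

variable {X J F : Type*} [Fintype X] [Fintype J] [Fintype F] [DecidableEq X]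
  (D : LinkDiagram X J F)

/-- The inclusion of the summand `V(L_S)`. -/
noncomputable abbrev incl (S : Finset X) : D.V S →ₗ[FaceRing F] D.KT :=
  DirectSum.lof (FaceRing F) (Finset X) (fun S => D.V S) S

/-- The map `v₊ ↦ v₋` on the circle through a half-edge, in all resolutions at once. -/
noncomputable def halfEdgeOp (h : HalfEdge X J) : D.KT →ₗ[FaceRing F] D.KT :=
  DirectSum.toModule (FaceRing F) (Finset X) D.KT fun S =>
    D.incl S ∘ₗ D.circleOp S (D.circleOf S h)

/-- The sum of all components of the Khovanov differential at the crossing `x`. -/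
noncomputable def crossingOp (x : X) : D.KT →ₗ[FaceRing F] D.KT :=
  DirectSum.toModule (FaceRing F) (Finset X) D.KT fun S =>
    if x ∈ S then 0 else D.incl (insert x S) ∘ₗ D.edgeMap S x

theorem halfEdgeOp_incl (h : HalfEdge X J) (S : Finset X) (v : D.V S) :
    D.halfEdgeOp h (D.incl S v) = D.incl S (D.circleOp S (D.circleOf S h) v) := by
  rw [halfEdgeOp, DirectSum.toModule_lof]
  rfl

theorem crossingOp_incl_of_mem {x : X} {S : Finset X} (hx : x ∈ S) (v : D.V S) :
    D.crossingOp x (D.incl S v) = 0 := by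
  rw [crossingOp, DirectSum.toModule_lof, if_pos hx]
  rfl

theorem crossingOp_incl {x : X} {S : Finset X} (hx : x ∉ S) (v : D.V S) :
    D.crossingOp x (D.incl S v) = D.incl (insert x S) (D.edgeMap S x v) := by
  rw [crossingOp, DirectSum.toModule_lof, if_neg hx]
  rfl

theorem dKoszul_incl (S : Finset X) (v : D.V S) :
    D.dKoszul (D.incl S v) = D.incl S (D.dV S v) := by
  rw [dKoszul, DirectSum.toModule_lof]
  rfl

theorem dKH_eq_sum : D.dKH = ∑ x, D.crossingOp x := by
  refine DirectSum.linearMap_ext _ fun S => LinearMap.ext fun v => ?_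
  rw [LinearMap.comp_apply, LinearMap.comp_apply, dKH, DirectSum.toModule_lof,
    LinearMap.sum_apply, LinearMap.sum_apply]
  refine (Finset.sum_congr rfl fun x hx => ?_).trans
    (Finset.sum_subset (Finset.subset_univ Sᶜ) fun x _ hx => ?_)
  · rw [D.crossingOp_incl (Finset.mem_compl.1 hx)]
    rfl
  · rw [Finset.mem_compl, not_not] at hx
    exact D.crossingOp_incl_of_mem hx v

theorem KT_hom_ext {M : Type*} [AddCommMonoid M] [Module (FaceRing F) M]
    {f g : D.KT →ₗ[FaceRing F] M} (h : ∀ S v, f (D.incl S v) = g (D.incl S v)) : f = g :=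
  DirectSum.linearMap_ext _ fun S => LinearMap.ext fun v => h S v

theorem crossingOp_halfEdgeOp (x : X) (h : HalfEdge X J) (v : D.KT) :
    D.crossingOp x (D.halfEdgeOp h v) = D.halfEdgeOp h (D.crossingOp x v) := by
  refine LinearMap.congr_fun (f := D.crossingOp x ∘ₗ D.halfEdgeOp h)
    (g := D.halfEdgeOp h ∘ₗ D.crossingOp x) (D.KT_hom_ext fun S v => ?_) v
  rw [LinearMap.comp_apply, LinearMap.comp_apply, halfEdgeOp_incl]
  by_cases hx : x ∈ S
  · rw [D.crossingOp_incl_of_mem hx, D.crossingOp_incl_of_mem hx, map_zero]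
  · rw [D.crossingOp_incl hx, D.crossingOp_incl hx, halfEdgeOp_incl, D.edgeMap_circleOp hx]

/-- The generator of `V(L_S)` with `v₊` on every unmarked circle. -/
noncomputable def vac (S : Finset X) : D.KT := D.incl S (Finsupp.single (D.plusState S) 1)

theorem crossingOp_vac_of_merges {x : X} {S : Finset X} (hx : x ∉ S)
    (hm : D.Merges S (insert x S) x) : D.crossingOp x (D.vac S) = D.vac (insert x S) := by
  rw [vac, D.crossingOp_incl hx, D.edgeMap_plusState_of_merges hm, vac]

theorem crossingOp_vac_of_divides {x : X} {S : Finset X} (hx : x ∉ S)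
    (hm : D.Merges (insert x S) S x) : D.crossingOp x (D.vac S) =
      D.halfEdgeOp (.inl (x, 0)) (D.vac (insert x S))
        + D.halfEdgeOp (.inl (x, 2)) (D.vac (insert x S)) := by
  rw [vac, D.crossingOp_incl hx, D.edgeMap_plusState_of_divides hm, map_add, vac,
    halfEdgeOp_incl, halfEdgeOp_incl]
  rfl

theorem halfEdgeOp_vac_congr {S : Finset X} {h k : HalfEdge X J}
    (hk : D.circleOf S h = D.circleOf S k) :
    D.halfEdgeOp h (D.vac S) = D.halfEdgeOp k (D.vac S) := by
  rw [vac, halfEdgeOp_incl, halfEdgeOp_incl, hk]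

theorem halfEdgeOp_comm (h k : HalfEdge X J) (v : D.KT) :
    D.halfEdgeOp h (D.halfEdgeOp k v) = D.halfEdgeOp k (D.halfEdgeOp h v) := by
  refine LinearMap.congr_fun (f := D.halfEdgeOp h ∘ₗ D.halfEdgeOp k)
    (g := D.halfEdgeOp k ∘ₗ D.halfEdgeOp h) (D.KT_hom_ext fun S v => ?_) v
  simp only [LinearMap.comp_apply, halfEdgeOp_incl]
  rw [circleOp_comm]

/-- If `x` and `y` divide the same circle, they divide it into the same circles. -/
theorem halfEdgeOp_add_vac_of_merges {S S' T' : Finset X} {x y : X}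
    (hm : D.Merges S S' y) (hx : D.Merges S T' x)
    (he : D.strandA S' x = D.strandB S' x) :
    D.halfEdgeOp (.inl (x, 0)) (D.vac S) + D.halfEdgeOp (.inl (x, 2)) (D.vac S)
      = D.halfEdgeOp (.inl (y, 0)) (D.vac S) + D.halfEdgeOp (.inl (y, 2)) (D.vac S) := by
  -- The two circles of `S` at `x` are different but become equal once `y` merges its circles, so
  -- they are the two circles at `y`, in some order.
  rcases hm.circleOf_eq_or he with h | ⟨h1 | h1, h2 | h2⟩
  · exact absurd h hx.ne
  · exact absurd (h1.trans h2.symm) hx.ne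
  · rw [D.halfEdgeOp_vac_congr h1, D.halfEdgeOp_vac_congr h2]
  · rw [D.halfEdgeOp_vac_congr h1, D.halfEdgeOp_vac_congr h2, add_comm]
  · exact absurd (h1.trans h2.symm) hx.ne

theorem halfEdgeOp_add_vac_of_eq {S : Finset X} {x : X} (he : D.strandA S x = D.strandB S x) :
    D.halfEdgeOp (.inl (x, 0)) (D.vac S) + D.halfEdgeOp (.inl (x, 2)) (D.vac S) = 0 := by
  rw [D.halfEdgeOp_vac_congr he]
  exact add_self_eq_zero_of_faceRing (F := F) _

/-- Each edge of the square changes the number of circles by one, and both paths have the same total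
change. This leaves six of the sixteen combinations of merges and divisions. -/
theorem crossingOp_comm_vac {x y : X} (hxy : x ≠ y) {S : Finset X} (hx : x ∉ S) (hy : y ∉ S) :
    D.crossingOp y (D.crossingOp x (D.vac S)) = D.crossingOp x (D.crossingOp y (D.vac S)) := by
  have hy' : y ∉ insert x S := by simp [hxy.symm, hy]
  have hx' : x ∉ insert y S := by simp [hxy, hx]
  have hc := Finset.insert_comm x y S
  rcases D.merges_or_merges (differAt_insert hx) with h1 | h1 <;>
    rcases D.merges_or_merges (differAt_insert hy') with h2 | h2 <;>
    rcases D.merges_or_merges (differAt_insert hy) with h3 | h3 <;>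
    rcases D.merges_or_merges (differAt_insert hx') with h4 | h4 <;>
    have c1 := h1.card_circle <;> have c2 := h2.card_circle <;>
    have c3 := h3.card_circle <;> have c4 := h4.card_circle <;>
    rw [hc] at c4 <;> try omega
  · rw [D.crossingOp_vac_of_merges hx h1, D.crossingOp_vac_of_merges hy h3,
      D.crossingOp_vac_of_merges hy' h2, D.crossingOp_vac_of_merges hx' h4, hc]
  · rw [D.crossingOp_vac_of_merges hx h1, D.crossingOp_vac_of_merges hy h3,
      D.crossingOp_vac_of_divides hy' h2, D.crossingOp_vac_of_divides hx' h4, hc]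
    rw [hc] at h4
    -- Both crossings join the same two circles; whichever is changed second divides the merged
    -- circle, and the resulting two circles are the same.
    exact (D.halfEdgeOp_add_vac_of_merges h2 h4 h1.eq).symm
  · rw [D.crossingOp_vac_of_merges hx h1, D.crossingOp_vac_of_divides hy h3, map_add,
      crossingOp_halfEdgeOp, crossingOp_halfEdgeOp,
      D.crossingOp_vac_of_divides hy' h2, D.crossingOp_vac_of_merges hx' h4, hc]
  · rw [D.crossingOp_vac_of_divides hx h1, D.crossingOp_vac_of_merges hy h3, map_add,
      crossingOp_halfEdgeOp, crossingOp_halfEdgeOp,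
      D.crossingOp_vac_of_merges hy' h2, D.crossingOp_vac_of_divides hx' h4, hc]
  · rw [D.crossingOp_vac_of_divides hx h1, D.crossingOp_vac_of_divides hy h3, map_add, map_add,
      crossingOp_halfEdgeOp, crossingOp_halfEdgeOp, crossingOp_halfEdgeOp, crossingOp_halfEdgeOp,
      D.crossingOp_vac_of_merges hy' h2, D.crossingOp_vac_of_merges hx' h4, hc]
    rw [hc] at h4
    -- Dividing and then merging again adds the same operator twice, so both paths give zero in
    -- characteristic two.
    rw [D.halfEdgeOp_add_vac_of_eq h4.eq, D.halfEdgeOp_add_vac_of_eq h2.eq]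
  · rw [D.crossingOp_vac_of_divides hx h1, D.crossingOp_vac_of_divides hy h3, map_add, map_add,
      crossingOp_halfEdgeOp, crossingOp_halfEdgeOp, crossingOp_halfEdgeOp, crossingOp_halfEdgeOp,
      D.crossingOp_vac_of_divides hy' h2, D.crossingOp_vac_of_divides hx' h4, hc]
    simp only [map_add, D.halfEdgeOp_comm (.inl (y, _))]
    abel

theorem crossingOp_crossingOp_self (x : X) (v : D.KT) : D.crossingOp x (D.crossingOp x v) = 0 := by
  refine LinearMap.congr_fun (f := D.crossingOp x ∘ₗ D.crossingOp x)
    (g := 0) (D.KT_hom_ext fun S v => ?_) v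
  rw [LinearMap.comp_apply, LinearMap.zero_apply]
  by_cases hx : x ∈ S
  · rw [D.crossingOp_incl_of_mem hx, map_zero]
  · rw [D.crossingOp_incl hx, D.crossingOp_incl_of_mem (Finset.mem_insert_self x S)]

theorem incl_setSign {S : Finset X} {s : D.PureState S} {h : HalfEdge X J}
    (hs : D.label s (D.circleOf S h) = some .plus) :
    D.incl S (Finsupp.single (D.setSign s (D.circleOf S h) .minus) 1)
      = D.halfEdgeOp h (D.incl S (Finsupp.single s 1)) := by
  rw [halfEdgeOp_incl, D.circleOp_single_of_plus S hs]

/-- Both composites commute with every `halfEdgeOp`, and these operators generate all pure states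
from the all-`v₊` state, so `crossingOp_comm_vac` suffices. -/
theorem crossingOp_comm (x y : X) (v : D.KT) :
    D.crossingOp y (D.crossingOp x v) = D.crossingOp x (D.crossingOp y v) := by
  by_cases hxy : x = y
  · rw [hxy]
  refine LinearMap.congr_fun (f := D.crossingOp y ∘ₗ D.crossingOp x)
    (g := D.crossingOp x ∘ₗ D.crossingOp y) (DirectSum.linearMap_ext _ fun S =>
      D.V_hom_ext fun s => ?_) v
  change D.crossingOp y (D.crossingOp x (D.incl S _)) = D.crossingOp x (D.crossingOp y (D.incl S _))
  have hmem : ∀ {x y : X} (v : D.V S), x ∈ S →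
      D.crossingOp x (D.crossingOp y (D.incl S v)) = 0 := fun {x y} v hx => by
    by_cases hy : y ∈ S
    · rw [D.crossingOp_incl_of_mem hy, map_zero]
    · rw [D.crossingOp_incl hy, D.crossingOp_incl_of_mem (Finset.mem_insert_of_mem hx)]
  by_cases hx : x ∈ S
  · rw [hmem _ hx, D.crossingOp_incl_of_mem hx, map_zero]
  by_cases hy : y ∈ S
  · rw [hmem _ hy, D.crossingOp_incl_of_mem hy, map_zero]
  induction s using D.pureState_induction with
  | plus => exact D.crossingOp_comm_vac hxy hx hy
  | step s h hs ih => rw [D.incl_setSign hs]; simp only [crossingOp_halfEdgeOp, ih]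

theorem dKH_comp_dKH : D.dKH ∘ₗ D.dKH = 0 := by
  rw [dKH_eq_sum]
  exact sum_mul_sum_eq_zero (A := Module.End (FaceRing F) D.KT)
    (add_self_eq_zero_of_faceRing (F := F)) D.crossingOp
    (fun x => LinearMap.ext (D.crossingOp_crossingOp_self x))
    (fun x y => LinearMap.ext (D.crossingOp_comm y x)) _

theorem dKoszul_comp_dKoszul : D.dKoszul ∘ₗ D.dKoszul = 0 := by
  refine D.KT_hom_ext fun S v => ?_
  rw [LinearMap.comp_apply, dKoszul_incl, dKoszul_incl, ← LinearMap.comp_apply (D.dV S),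
    dV_comp_dV, LinearMap.zero_apply, LinearMap.zero_apply, map_zero]

theorem dKH_comp_dKoszul : D.dKH ∘ₗ D.dKoszul = D.dKoszul ∘ₗ D.dKH := by
  refine D.KT_hom_ext fun S v => ?_
  rw [LinearMap.comp_apply, LinearMap.comp_apply, dKoszul_incl, dKH_eq_sum, LinearMap.sum_apply,
    LinearMap.sum_apply, map_sum]
  refine Finset.sum_congr rfl fun x _ => ?_
  by_cases hx : x ∈ S
  · rw [D.crossingOp_incl_of_mem hx, D.crossingOp_incl_of_mem hx, map_zero]
  · rw [D.crossingOp_incl hx, D.crossingOp_incl hx, dKoszul_incl]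
    exact congrArg _ (LinearMap.congr_fun (D.edgeMap_comp_dV hx) v)

theorem total_comp_total : (D.dKH + D.dKoszul) ∘ₗ (D.dKH + D.dKoszul) = 0 := by
  rw [LinearMap.add_comp, LinearMap.comp_add, LinearMap.comp_add, dKH_comp_dKH,
    dKoszul_comp_dKoszul, dKH_comp_dKoszul, zero_add, add_zero]
  exact add_self_eq_zero_of_faceRing (F := F) _

theorem incl_mem_bigraded {S : Finset X} (s : D.PureState S) {i j : ℤ} (hi : (S.card : ℤ) = i)
    (hj : D.qDeg s = j) : D.incl S (Finsupp.single s 1) ∈ D.bigraded i j :=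
  Submodule.subset_span ⟨S, s, hi, hj, rfl⟩

theorem map_mem_bigraded {f : D.KT →ₗ[FaceRing F] D.KT} {i j i' j' : ℤ}
    (hf : ∀ (S : Finset X) (s : D.PureState S), (S.card : ℤ) = i → D.qDeg s = j →
      f (D.incl S (Finsupp.single s 1)) ∈ D.bigraded i' j') {v : D.KT}
    (hv : v ∈ D.bigraded i j) : f v ∈ D.bigraded i' j' := by
  have : D.bigraded i j ≤ (D.bigraded i' j').comap f := by
    refine Submodule.span_le.2 ?_
    rintro _ ⟨S, s, hi, hj, rfl⟩
    exact hf S s hi hj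
  exact this hv

theorem halfEdgeOp_mem_bigraded (h : HalfEdge X J) {i j : ℤ} {v : D.KT}
    (hv : v ∈ D.bigraded i j) : D.halfEdgeOp h v ∈ D.bigraded i (j - 2) := by
  refine D.map_mem_bigraded (fun S s hi hj => ?_) hv
  by_cases hs : D.label s (D.circleOf S h) = some .plus
  · rw [← D.incl_setSign hs]
    exact D.incl_mem_bigraded _ hi (by rw [D.qDeg_setSign hs, hj])
  · rw [halfEdgeOp_incl, circleOp_single, if_neg hs, map_zero]
    exact Submodule.zero_mem _

theorem dKoszul_mem_bigraded {i j : ℤ} {v : D.KT} (hv : v ∈ D.bigraded i j) :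
    D.dKoszul v ∈ D.bigraded i (j - 2) := by
  refine D.map_mem_bigraded (fun S s hi hj => ?_) hv
  rw [dKoszul_incl, dV_apply, map_sum]
  refine Submodule.sum_mem _ fun C _ => ?_
  obtain ⟨h, rfl⟩ := D.exists_circleOf_eq S C
  rw [map_smul, ← halfEdgeOp_incl]
  exact Submodule.smul_mem _ _ (D.halfEdgeOp_mem_bigraded h (D.incl_mem_bigraded s hi hj))

theorem crossingOp_mem_bigraded (x : X) {i j : ℤ} {v : D.KT} (hv : v ∈ D.bigraded i j) :
    D.crossingOp x v ∈ D.bigraded (i + 1) j := by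
  refine D.map_mem_bigraded (fun S s hi hj => ?_) hv
  by_cases hx : x ∈ S
  · rw [D.crossingOp_incl_of_mem hx]
    exact Submodule.zero_mem _
  have hcard : ((insert x S).card : ℤ) = i + 1 := by
    rw [Finset.card_insert_of_notMem hx, ← hi, Nat.cast_add, Nat.cast_one]
  subst hj
  clear hv v
  induction s using D.pureState_induction with
  | plus =>
    have hq := D.qDeg_plusState (S := S)
    have hq' := D.qDeg_plusState (S := insert x S)
    change D.crossingOp x (D.vac S) ∈ _
    rcases D.merges_or_merges (differAt_insert hx) with hm | hm
    · rw [D.crossingOp_vac_of_merges hx hm]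
      refine D.incl_mem_bigraded _ hcard ?_
      have := hm.card_circle
      omega
    · rw [D.crossingOp_vac_of_divides hx hm]
      -- A division adds one circle and one to `|S|`, raising the degree of the all-`v₊` state by
      -- two; the operator in the formula for the division lowers it again by two.
      have hv : D.vac (insert x S) ∈ D.bigraded (i + 1) (D.qDeg (D.plusState S) + 2) := by
        refine D.incl_mem_bigraded _ hcard ?_
        have := hm.card_circle
        omega
      have h2 := fun h => D.halfEdgeOp_mem_bigraded h hv
      rw [add_sub_cancel_right] at h2
      exact Submodule.add_mem _ (h2 _) (h2 _)
  | step s h hs ih =>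
    rw [D.incl_setSign hs, crossingOp_halfEdgeOp, D.qDeg_setSign hs]
    exact D.halfEdgeOp_mem_bigraded h ih

theorem dKH_mem_bigraded {i j : ℤ} {v : D.KT} (hv : v ∈ D.bigraded i j) :
    D.dKH v ∈ D.bigraded (i + 1) j := by
  rw [dKH_eq_sum, LinearMap.sum_apply]
  exact Submodule.sum_mem _ fun x _ => D.crossingOp_mem_bigraded x hv

end Total

end LinkDiagram
end TotallyTwisted

open TotallyTwisted in
theorem mainTheorem4 {X J F : Type*} [Fintype X] [Fintype J] [Fintype F] [DecidableEq X]
    (D : LinkDiagram X J F) :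
    -- two circles that meet at a crossing merge, and areas add up
    (∀ (S : Finset X) (x : X), x ∉ S → D.strandA S x ≠ D.strandB S x →
      D.strandA (insert x S) x = D.strandB (insert x S) x ∧
      ∀ (C₁ C₂ : D.Unmarked S) (C : D.Unmarked (insert x S)),
        C₁.1 = D.strandA S x → C₂.1 = D.strandB S x → C.1 = D.strandA (insert x S) x →
        D.area (insert x S) C = D.area S C₁ + D.area S C₂) ∧
    -- a circle that meets itself at a crossing divides, and areas add up
    (∀ (S : Finset X) (x : X), x ∉ S → D.strandA S x = D.strandB S x →
      D.strandA (insert x S) x ≠ D.strandB (insert x S) x ∧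
      ∀ (C : D.Unmarked S) (C₁ C₂ : D.Unmarked (insert x S)),
        C.1 = D.strandA S x → C₁.1 = D.strandA (insert x S) x →
        C₂.1 = D.strandB (insert x S) x →
        D.area S C = D.area (insert x S) C₁ + D.area (insert x S) C₂) ∧
    -- the merging and dividing maps are chain maps of Koszul complexes
    (∀ (S : Finset X) (x : X), x ∉ S →
      D.edgeMap S x ∘ₗ D.dV S = D.dV (insert x S) ∘ₗ D.edgeMap S x) ∧
    -- the bidegrees
    (∀ (i j : ℤ), ∀ v ∈ D.bigraded i j, D.dKH v ∈ D.bigraded (i + 1) j) ∧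
    (∀ (i j : ℤ), ∀ v ∈ D.bigraded i j, D.dKoszul v ∈ D.bigraded i (j - 2)) ∧
    -- the differentials
    D.dKH ∘ₗ D.dKH = 0 ∧
    D.dKoszul ∘ₗ D.dKoszul = 0 ∧
    (D.dKH + D.dKoszul) ∘ₗ (D.dKH + D.dKoszul) = 0 := by

  refine ⟨fun S x hx hne => ?_, fun S x hx he => ?_, fun S x hx => D.edgeMap_comp_dV hx,
    fun i j v hv => D.dKH_mem_bigraded hv, fun i j v hv => D.dKoszul_mem_bigraded hv,
    D.dKH_comp_dKH, D.dKoszul_comp_dKoszul, D.total_comp_total⟩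
  · have hm := (D.merges_or_merges (LinkDiagram.differAt_insert hx)).resolve_right
      fun hm => hne hm.eq
    exact ⟨hm.eq, fun C₁ C₂ C h₁ h₂ h => hm.area_eq_add h₁ h₂ h⟩
  · have hm := (D.merges_or_merges (LinkDiagram.differAt_insert hx)).resolve_left
      fun hm => hm.ne he
    exact ⟨hm.ne, fun C C₁ C₂ h h₁ h₂ => hm.area_eq_add h₁ h₂ h⟩
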